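/- All manifolds, maps, vector fields, actions, metrics and foliations are $C^\infty$, finite-dimensional and without boundary. Let $M$ be a compact Hausdorff manifold. Each leaf of a foliation carries its leaf topology (generated by the relatively open subsets of plaques). A foliation $\mathcal N$ is preserved by a map $f$ if $df(T_x\mathcal N)=T_{f(x)}\mathcal N$ for all $x$. (1) Let $X$ be a nowhere vanishing vector field on $M$ generating an equicontinuous flow $\varphi^t$, that is, a flow preserving some Riemannian metric on $M$, and let $\mathcal N$ be a foliation of $M$ of codimension $1$ that is everywhere transverse to $X$ and is preserved by every $\varphi^t$. Then: (a) For every $x_0\in M$, with $N_0$ the leaf of $\mathcal N$ through $x_0$, the map $p:\mathbb R\times N_0\to M$, $p(t,x)=\varphi^t(x)$, is a covering map, and it is surjective if $M$ is connected. (b) $X$ and $\mathcal N$ define a global product structure on the universal cover: for every covering map $\pi:\tilde M\to M$ with $\tilde M$ simply connected, $\varphi^t$ lifts to a flow $\tilde\varphi^t$ of $\tilde M$ such that for every leaf $L$ of the lifted foliation $\tilde{\mathcal N}$ the map $\mathbb R\times L\to\tilde M$, $(t,z)\mapsto\tilde\varphi^t(z)$, is a homeomorphism, and each $\tilde\varphi^t(L)$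 is a leaf of $\tilde{\mathcal N}$. (2) Let $K$ be a compact Lie group (Hausdorff, not necessarily connected) acting smoothly on $M$ such that the action is locally free (all stabilizers are discrete), and suppose that every element of $K$ preserves a foliation $\mathcal N$ of $M$ with $T_xM=T_x(Kx)\oplus T_x\mathcal N$ for all $x\in M$. Then for every $x_0\in M$, with $N_0$ the leaf of $\mathcal N$ through $x_0$, the map $p:K\times N_0\to M$, $p(g,x)=gx$, is a covering map, it is surjective if $M$ is connected, and it is $K$-equivariant, where $K$ acts on $K\times N_0$ by left multiplication on the first factor. -/

import Mathlib

open scoped Manifold ContDiff Topology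

/-- The connected component of `y` in the space `Y` endowed with the topology `t`, as a type. -/
def ComponentOf {Y : Type*} (t : TopologicalSpace Y) (y : Y) : Type _ :=
  {z : Y // z ∈ @connectedComponent Y t y}

/-- The inclusion of a component into the ambient set. -/
def ComponentOf.val {Y : Type*} {t : TopologicalSpace Y} {y : Y} (z : ComponentOf t y) : Y :=
  Subtype.val z

/-- A component carries the topology induced by `t` (not by any other topology of `Y`). -/
instance ComponentOf.instTopologicalSpace {Y : Type*} (t : TopologicalSpace Y) (y : Y) :
    TopologicalSpace (ComponentOf t y) :=
  TopologicalSpace.induced ComponentOf.val t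

/-- A smooth foliation of `M` with leaves modelled on `F` and transverse model `G`, given by a
foliated atlas: smooth charts with values in `F × G` whose domains cover `M` and whose
coordinate changes send, locally, plaques (`second coordinate = constant`) into plaques. -/
structure Foliation {E : Type*} [NormedAddCommGroup E] [NormedSpace ℝ E]
    {H : Type*} [TopologicalSpace H] (I : ModelWithCorners ℝ E H)
    (M : Type*) [TopologicalSpace M] [ChartedSpace H M]
    (F : Type*) [NormedAddCommGroup F] [NormedSpace ℝ F]
    (G : Type*) [NormedAddCommGroup G] [NormedSpace ℝ G] where
  /-- The foliated charts. -/
  charts : Set (OpenPartialHomeomorph M (F × G))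
  contMDiffOn_chart : ∀ κ ∈ charts, ContMDiffOn I 𝓘(ℝ, F × G) ∞ κ κ.source
  contMDiffOn_symm : ∀ κ ∈ charts, ContMDiffOn 𝓘(ℝ, F × G) I ∞ κ.symm κ.target
  cover : ∀ x : M, ∃ κ ∈ charts, x ∈ κ.source
  compatible : ∀ κ ∈ charts, ∀ κ' ∈ charts, ∀ x ∈ κ.source ∩ κ'.source, ∃ U ∈ 𝓝 x,
    ∀ y ∈ U, ∀ z ∈ U, (κ y).2 = (κ z).2 → (κ' y).2 = (κ' z).2

namespace Foliation

variable {E : Type*} [NormedAddCommGroup E] [NormedSpace ℝ E]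
  {H : Type*} [TopologicalSpace H] {I : ModelWithCorners ℝ E H}
  {M : Type*} [TopologicalSpace M] [ChartedSpace H M]
  {F : Type*} [NormedAddCommGroup F] [NormedSpace ℝ F]
  {G : Type*} [NormedAddCommGroup G] [NormedSpace ℝ G]

/-- The plaque of height `c` in the chart `κ`. -/
def plaque (κ : OpenPartialHomeomorph M (F × G)) (c : G) : Set M :=
  {x | x ∈ κ.source ∧ (κ x).2 = c}

/-- The tangent space at `x` to the leaf through `x`: the kernel of the derivative of the transverse
coordinate of a foliated chart (the kernels for different charts around `x` coincide). -/
noncomputable def tangentSpace (𝓕 : Foliation I M F G) (x : M) :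
    Submodule ℝ (TangentSpace I x) :=
  ⨅ κ ∈ 𝓕.charts, ⨅ _ : x ∈ κ.source,
    LinearMap.ker (mfderiv I 𝓘(ℝ, G) (fun y => (κ y).2) x).toLinearMap

/-- The leaf topology on the set `M`: it is generated by the relatively open subsets of plaques. -/
@[reducible] def leafTopology (𝓕 : Foliation I M F G) : TopologicalSpace M :=
  TopologicalSpace.generateFrom
    {P | ∃ V : Set M, IsOpen V ∧ ∃ κ ∈ 𝓕.charts, ∃ c : G, P = V ∩ plaque κ c}

/-- The leaf through `x`, with its leaf (immersed manifold) topology. -/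
abbrev Leaf (𝓕 : Foliation I M F G) (x : M) : Type _ := ComponentOf 𝓕.leafTopology x

/-- A self-map of `M` preserves the foliation when its differential maps the tangent space of the
leaf at each point onto the tangent space of the leaf at the image point. -/
def IsPreservedBy (𝓕 : Foliation I M F G) (f : M → M) : Prop :=
  ∀ x, (𝓕.tangentSpace x).map (mfderiv I I f x).toLinearMap = 𝓕.tangentSpace (f x)

/-- The leaf topology of the foliation lifted to a covering space `π : N → M`. The lifted foliated
charts are `κ ∘ π` on the sheets of `π`, so that the relatively open subsets of the lifted
plaques generate the coarsest topology finer than both the topology of `N` and the pullback of the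
leaf topology of `M`. -/
@[reducible] def liftedLeafTopology (𝓕 : Foliation I M F G) {N : Type*} [τ : TopologicalSpace N] (π : N → M) :
    TopologicalSpace N :=
  τ ⊓ TopologicalSpace.induced π 𝓕.leafTopology

/-- The flow `φ` and the foliation lift through `π : N → M` to a global product structure on `N`:
`φ` lifts to a flow `ψ` of `N`, and for every leaf `L` of the lifted foliation the map
`(t, z) ↦ ψ t z` is a homeomorphism from `ℝ × L` onto `N`, which carries each slice `{t} × L`
onto a leaf of the lifted foliation (and each line `ℝ × {z}` onto an orbit of `ψ`). -/
def LiftsToGlobalProduct (𝓕 : Foliation I M F G) (φ : Flow ℝ M)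
    {N : Type*} [TopologicalSpace N] (π : N → M) : Prop :=
  ∃ ψ : Flow ℝ N, (∀ t z, π (ψ t z) = φ t (π z)) ∧
    ∀ z₀ : N,
      IsHomeomorph (fun q : ℝ × ComponentOf (𝓕.liftedLeafTopology π) z₀ => ψ q.1 q.2.val) ∧
      ∀ t : ℝ, ψ t '' (@connectedComponent N (𝓕.liftedLeafTopology π) z₀) =
        @connectedComponent N (𝓕.liftedLeafTopology π) (ψ t z₀)

end Foliation

/-- A self-map `f` of `M` preserves the Riemannian metric `g`. -/
def PreservesMetric {E : Type*} [NormedAddCommGroup E] [NormedSpace ℝ E]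
    {H : Type*} [TopologicalSpace H] {I : ModelWithCorners ℝ E H}
    {M : Type*} [TopologicalSpace M] [ChartedSpace H M] [IsManifold I ∞ M]
    (g : Bundle.ContMDiffRiemannianMetric I ∞ E (fun x : M => TangentSpace I x))
    (f : M → M) : Prop :=
  ∀ (x : M) (v w : TangentSpace I x),
    g.inner (f x) (mfderiv I I f x v) (mfderiv I I f x w) = g.inner x v w

/-- A flow is equicontinuous when it preserves some smooth Riemannian metric. -/
def IsEquicontinuousFlow {E : Type*} [NormedAddCommGroup E] [NormedSpace ℝ E]
    {H : Type*} [TopologicalSpace H] (I : ModelWithCorners ℝ E H)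
    {M : Type*} [TopologicalSpace M] [ChartedSpace H M] [IsManifold I ∞ M]
    (φ : Flow ℝ M) : Prop :=
  ∃ g : Bundle.ContMDiffRiemannianMetric I ∞ E (fun x : M => TangentSpace I x),
    ∀ t : ℝ, PreservesMetric g (φ t)

/-- An action is locally free when all stabilizers are discrete. -/
def IsLocallyFreeAction (K M : Type*) [Group K] [TopologicalSpace K] [MulAction K M] : Prop :=
  ∀ x : M, DiscreteTopology (MulAction.stabilizer K x)

/-- The tangent space at `x` to the orbit of `x` under a smooth action of a Lie group `K`. -/
noncomputable def orbitTangentSpace {E : Type*} [NormedAddCommGroup E] [NormedSpace ℝ E]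
    {H : Type*} [TopologicalSpace H] (I : ModelWithCorners ℝ E H)
    {M : Type*} [TopologicalSpace M] [ChartedSpace H M]
    {E' : Type*} [NormedAddCommGroup E'] [NormedSpace ℝ E']
    {H' : Type*} [TopologicalSpace H'] (J : ModelWithCorners ℝ E' H')
    (K : Type*) [Group K] [TopologicalSpace K] [ChartedSpace H' K] [MulAction K M] (x : M) :
    Submodule ℝ (TangentSpace I ((1 : K) • x)) :=
  LinearMap.range (mfderiv J I (fun k : K => k • x) 1).toLinearMap

/-!
In both parts a topological group `K` (the line, acting by the flow, or the Lie group) acts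
on `M` so that each of its elements is a homeomorphism for the topology of `M` and for the finer leaf
topology, and so that the orbits are transverse to the leaves. Everything follows from these two facts.

*The leaf topology is preserved.* The elements of `K` are differentiable; for the flow this
is forced by the invariant metric. In foliated charts, the transverse coordinate of the image of a
point has zero derivative along the plaques, so it is locally constant on them
(`Foliation.IsPreservedBy.continuous_leafTopology`).

*Local slices.* Transversality makes the plaque `Q` of a foliated chart through `x` a local slice:
every `m` near `x` is moved into `Q` by exactly one element `w m` of `K` near `1`, which depends
continuously on `m` (`HasLocalSlice`). This is an implicit function theorem for the transverse
coordinate of `k • m`, seen as a function of `k` with parameter `m`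
(`exists_continuousOn_implicit`). The flow is only assumed to be jointly continuous,
so the parameter enters this theorem only continuously. For the
Lie group, the derivative in the direction of `K` is invertible because the differential of an orbit
map of a locally free action is injective: the integral curve through `1` of the left
invariant vector field of a vector in the kernel would stay in a discrete stabilizer (`injective_mfderiv_orbit`).

*Coverings.* Slices give neighbourhoods which are products of an open subset `W` of `K` and of a
connected, leaf-open set `P`. For such a neighbourhood of `l`, the part of `K × N₀`, for a leaf
`N₀`, that `(k, x) ↦ k • x` maps into it is a disjoint union of copies of `W × P`, indexed by the elements `s` for
which `s⁻¹ • l` lies in `N₀` (`isCoveringMap_smul_component`). The sets `K • N`, for `N` a leaf, are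
open and pairwise equal or disjoint, which gives surjectivity if `M` is connected.

*Product structure.* The flow lifts to a simply connected covering space by uniqueness of lifts, and
the lifted leaf topology inherits invariance, local connectedness and slices. So the same covering
theorem applies upstairs: `ℝ × L → N` is a covering map from a connected space to a simply
connected one, hence a homeomorphism (`exists_lift_flow_isHomeomorph`).
-/

section

open Set Filter

/-! ### Group actions with a transverse second topology -/

/-- A copy of the type `S`, with the discrete topology whatever other topology `S` carries. -/
structure Discretization (S : Type*) where
  /-- The copy of an element of `S`. -/
  of ::
  /-- The underlying element of `S`. -/
  val : S

instance (S : Type*) : TopologicalSpace (Discretization S) := ⊥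

instance (S : Type*) : DiscreteTopology (Discretization S) := ⟨rfl⟩

/-- `HasLocalSlice K ι l`, for a bijection `ι` from a space `L` onto a space `Y` on which `K` acts
(`L` is `Y` with a finer topology, the leaf topology in the applications): there is a slice `Q ∋ l`
whose `L`-neighbourhoods are the traces of the `Y`-neighbourhoods, such that every point `m` of `Y`
near `ι l` is moved into `Q` by exactly one element `w m` of `K` near `1`, and `w` is
continuous. -/
@[to_additive HasLocalVAddSlice /-- `HasLocalVAddSlice K ι l`, for a bijection `ι` from a space `L`
onto a space `Y` on which `K` acts: the additive version of `HasLocalSlice`. -/]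
def HasLocalSlice (K : Type*) [Group K] [TopologicalSpace K] {Y L : Type*}
    [TopologicalSpace Y] [TopologicalSpace L] [MulAction K Y] (ι : L ≃ Y) (l : L) : Prop :=
  ∃ (B : Set Y) (W : Set K) (Q : Set L) (w : Y → K),
    B ∈ 𝓝 (ι l) ∧ W ∈ 𝓝 (1 : K) ∧ l ∈ Q ∧
    (∀ q ∈ Q, 𝓝 q = comap ι (𝓝 (ι q)) ⊓ 𝓟 Q) ∧
    ContinuousOn w B ∧ w (ι l) = 1 ∧
    (∀ m ∈ B, ι.symm (w m • m) ∈ Q) ∧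
    ∀ m ∈ B, ∀ k ∈ W, ι.symm (k • m) ∈ Q → k = w m

section Slices

variable {K : Type*} [Group K] [TopologicalSpace K] [IsTopologicalGroup K]
  {Y L : Type*} [TopologicalSpace Y] [τ : TopologicalSpace L]
  [MulAction K Y] [ContinuousSMul K Y] {ι : L ≃ Y}

/-- A neighbourhood `U` of `ι l` is, through `(k, p) ↦ k • ι p`, a product of a neighbourhood `W` of
`1` and of a connected open subset `P` of `L`; the two coordinates are the functions `u`
and `z`. -/
@[to_additive]
theorem HasLocalSlice.exists_product [LocallyConnectedSpace L] (hι : Continuous ι) {l : L}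
    (h : HasLocalSlice K ι l) :
    ∃ (U : Set Y) (W : Set K) (P : Set L) (u : Y → K) (z : Y → L),
      IsOpen U ∧ ι l ∈ U ∧ IsOpen W ∧ IsOpen P ∧ IsPreconnected P ∧ l ∈ P ∧
      ContinuousOn u U ∧ ContinuousOn z U ∧
      (∀ m ∈ U, u m ∈ W ∧ z m ∈ P ∧ u m • ι (z m) = m) ∧
      ∀ k ∈ W, ∀ p ∈ P, k • ι p ∈ U ∧ u (k • ι p) = k ∧ z (k • ι p) = p := by
  obtain ⟨B₀, W₀, Q, w, hB₀, hW₀, hlQ, hQ, hw, hwl, hwQ, huniq⟩ := h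
  obtain ⟨B, hBB₀, hB, hlB⟩ := mem_nhds_iff.1 hB₀
  replace hw := hw.mono hBB₀
  have hQo : IsOpen Q := by
    rw [isOpen_iff_mem_nhds]
    intro q hq
    rw [hQ q hq]
    exact mem_inf_of_right (mem_principal_self Q)
  -- the `L`-valued projection to the slice is continuous
  have hz : ContinuousOn (fun m => ι.symm (w m • m)) B := by
    intro m hm
    have hmQ := hwQ m (hBB₀ hm)
    rw [ContinuousWithinAt, hQ _ hmQ, tendsto_inf]
    refine ⟨?_, ?_⟩
    · rw [tendsto_comap_iff]
      have : ContinuousWithinAt (fun m => w m • m) B m :=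
        (hw m hm).smul continuousWithinAt_id
      simpa [Function.comp_def, ContinuousWithinAt] using this
    · rw [tendsto_principal]
      filter_upwards [self_mem_nhdsWithin] with m' hm'
      exact hwQ m' (hBB₀ hm')
  have hact : Continuous (fun q : K × L => q.1 • ι q.2) :=
    continuous_fst.smul (hι.comp continuous_snd)
  have hpre : (fun q : K × L => q.1 • ι q.2) ⁻¹' B ∈ 𝓝 ((1 : K), l) :=
    hact.continuousAt.preimage_mem_nhds (by simpa using hB.mem_nhds hlB)
  rw [nhds_prod_eq, mem_prod_iff] at hpre
  obtain ⟨W₁, hW₁, P₁, hP₁, hWP⟩ := hpre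
  obtain ⟨W, hWsub, hWo, hW1⟩ := mem_nhds_iff.1 (inter_mem hW₁
    (continuous_inv.continuousAt.preimage_mem_nhds (by simpa using hW₀) :
      (fun k : K => k⁻¹) ⁻¹' W₀ ∈ 𝓝 1))
  obtain ⟨P, hPsub, hPo, hlP, hPc⟩ := locallyConnectedSpace_iff_subsets_isOpen_isConnected.1
    ‹_› l (P₁ ∩ Q) (inter_mem hP₁ (hQo.mem_nhds hlQ))
  refine ⟨B ∩ (fun m => ((w m)⁻¹, ι.symm (w m • m))) ⁻¹' (W ×ˢ P), W, P, fun m => (w m)⁻¹,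
    fun m => ι.symm (w m • m), (hw.inv.prodMk hz).isOpen_inter_preimage hB (hWo.prod hPo),
    ⟨hlB, by simp [hwl, hW1, hlP]⟩, hWo, hPo, hPc.isPreconnected, hlP, hw.inv.mono inter_subset_left,
    hz.mono inter_subset_left, fun m hm => ⟨hm.2.1, hm.2.2, by simp⟩, fun k hk p hp => ?_⟩
  have hmB : k • ι p ∈ B := hWP (show (k, p) ∈ W₁ ×ˢ P₁ from ⟨(hWsub hk).1, (hPsub hp).1⟩)
  have hkw : k⁻¹ = w (k • ι p) :=
    huniq _ (hBB₀ hmB) _ (hWsub hk).2 (by simpa using (hPsub hp).2)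
  have hkw' : (w (k • ι p))⁻¹ = k := by rw [← hkw, inv_inv]
  have hp' : ι.symm (w (k • ι p) • k • ι p) = p := by rw [← hkw]; simp
  exact ⟨⟨hmB, by simp only [mem_preimage, mem_prod, hkw', hp']; exact ⟨hk, hp⟩⟩, hkw', hp'⟩

variable [MulAction K L] [ContinuousConstSMul K L]

/-- If all elements of `K` are homeomorphisms of `L` and there are local slices everywhere, then
translating one component of `L` by `K` is a covering map. Over a product neighbourhood `W • P` of
`ι l`, the sheets are indexed by the elements `s` of `K` for which `s⁻¹ • l` lies in the given
component: since `P` is connected, this condition is the same for all points of `P`. -/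
@[to_additive]
theorem isCoveringMap_smul_component [LocallyConnectedSpace L] (hι : Continuous ι)
    (hι' : ∀ (k : K) (l : L), ι (k • l) = k • ι l) (hs : ∀ l, HasLocalSlice K ι l) (l₀ : L) :
    IsCoveringMap (fun q : K × ComponentOf τ l₀ => q.1 • ι q.2.val) := by
  intro y
  obtain ⟨l, rfl⟩ := ι.surjective y
  obtain ⟨U, W, P, u, z, hU, hlU, hW, hP, hPc, hlP, hu, hz, h₁, h₂⟩ := (hs l).exists_product hι
  set f := fun q : K × ComponentOf τ l₀ => q.1 • ι q.2.val with hf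
  have hval : Continuous (ComponentOf.val : ComponentOf τ l₀ → L) := continuous_induced_dom
  have hfc : Continuous f := continuous_fst.smul (hι.comp (hval.comp continuous_snd))
  -- translates of `P` do not leave a component
  have hcomp : ∀ (s : K) {p p' : L}, p ∈ P → p' ∈ P → s • p ∈ connectedComponent l₀ →
      s • p' ∈ connectedComponent l₀ := by
    intro s p p' hp hp' hsp
    rw [connectedComponent_eq hsp]
    exact (hPc.image _ (continuous_const_smul s).continuousOn).subset_connectedComponent
      (mem_image_of_mem _ hp) (mem_image_of_mem _ hp')
  have hkey : ∀ q : K × ComponentOf τ l₀, f q ∈ U →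
      z (f q) = ((u (f q))⁻¹ * q.1) • q.2.val := by
    intro q hq
    apply ι.injective
    rw [hι', mul_smul, eq_inv_smul_iff]
    exact (h₁ _ hq).2.2
  let S := {s : K // s⁻¹ • l ∈ connectedComponent l₀}
  have hS : ∀ q : f ⁻¹' U, ((u (f q))⁻¹ * q.1.1)⁻¹ • l ∈ connectedComponent l₀ := by
    intro q
    refine hcomp _ (h₁ _ q.2).2.1 hlP ?_
    rw [hkey _ q.2, inv_smul_smul]
    exact q.1.2.2
  have hinv : ∀ (m : U) (s : S), s.1⁻¹ • z m ∈ connectedComponent l₀ := fun m s =>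
    hcomp _ hlP (h₁ _ m.2).2.1 s.2
  let g : U × Discretization S → K × ComponentOf τ l₀ := fun r =>
    (u r.1 * r.2.val.1, ⟨r.2.val.1⁻¹ • z r.1, hinv r.1 r.2.val⟩)
  have hfg : ∀ r, f (g r) = r.1 := by
    intro r
    change (u r.1 * r.2.val.1) • ι (r.2.val.1⁻¹ • z r.1) = r.1
    rw [hι', mul_smul, smul_inv_smul]
    exact (h₁ _ r.1.2).2.2
  have hgc : Continuous g := by
    have hu' : Continuous fun m : U => u m := continuousOn_iff_continuous_domRestrict.1 hu
    have hz' : Continuous fun m : U => z m := continuousOn_iff_continuous_domRestrict.1 hz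
    rw [continuous_prod_of_discrete_right]
    intro s
    have hc : Continuous fun m : U =>
        (⟨s.val.1⁻¹ • z m, hinv m s.val⟩ : ComponentOf τ l₀) :=
      continuous_induced_rng.2
        (show Continuous fun m : U => s.val.1⁻¹ • z m from hz'.const_smul _)
    exact (show Continuous fun m : U => u m * s.val.1 from hu'.mul continuous_const).prodMk hc
  have hgU : ∀ r, g r ∈ f ⁻¹' U := fun r => by
    rw [mem_preimage, hfg]
    exact r.1.2
  refine IsEvenlyCovered.to_isEvenlyCovered_preimage (I := Discretization S)
    ⟨inferInstance, U, hlU, hU, hU.preimage hfc,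
    { toFun := fun q => (⟨f q, q.2⟩, Discretization.of ⟨(u (f q))⁻¹ * q.1.1, hS q⟩)
      invFun := fun r => ⟨g r, hgU r⟩
      left_inv := ?_
      right_inv := ?_
      continuous_toFun := ?_
      continuous_invFun := hgc.subtype_mk hgU }, fun q => rfl⟩
  · rintro ⟨q, hq⟩
    apply Subtype.ext
    refine Prod.ext (mul_inv_cancel_left _ _) (Subtype.ext ?_)
    change ((u (f q))⁻¹ * q.1)⁻¹ • z (f q) = q.2.val
    rw [hkey q hq, inv_smul_smul]
  · rintro ⟨m, s⟩
    refine Prod.ext (Subtype.ext (hfg _)) (congrArg Discretization.of (Subtype.ext ?_))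
    change (u (f (g (m, s))))⁻¹ * (u m * s.val.1) = s.val.1
    rw [hfg, inv_mul_cancel_left]
  · refine Continuous.prodMk ((hfc.comp continuous_subtype_val).subtype_mk _) ?_
    rw [continuous_iff_continuousAt]
    rintro ⟨q₀, hq₀⟩
    -- the index of the sheet is locally constant
    refine ContinuousAt.congr (continuousAt_const (y := Discretization.of (⟨_, hS ⟨q₀, hq₀⟩⟩ : S))) ?_
    set s := (u (f q₀))⁻¹ * q₀.1 with hs
    have e₁ : ∀ᶠ q : f ⁻¹' U in 𝓝 ⟨q₀, hq₀⟩, q.1.1 * s⁻¹ ∈ W := by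
      have hc : Continuous fun q : f ⁻¹' U => q.1.1 * s⁻¹ :=
        (continuous_fst.comp continuous_subtype_val).mul continuous_const
      refine hc.continuousAt.preimage_mem_nhds (hW.mem_nhds ?_)
      have : q₀.1 * s⁻¹ = u (f q₀) := by rw [hs, mul_inv_rev, inv_inv, mul_inv_cancel_left]
      rw [this]
      exact (h₁ _ hq₀).1
    have e₂ : ∀ᶠ q : f ⁻¹' U in 𝓝 ⟨q₀, hq₀⟩, s • q.1.2.val ∈ P := by
      have hc : Continuous fun q : f ⁻¹' U => s • q.1.2.val :=
        (hval.comp (continuous_snd.comp continuous_subtype_val)).const_smul s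
      refine hc.continuousAt.preimage_mem_nhds (hP.mem_nhds ?_)
      change s • q₀.2.val ∈ P
      rw [← hkey q₀ hq₀]
      exact (h₁ _ hq₀).2.1
    filter_upwards [e₁, e₂] with q hq₁ hq₂
    refine congrArg Discretization.of (Subtype.ext ?_)
    change s = (u (f q))⁻¹ * q.1.1
    have h₃ := (h₂ _ hq₁ _ hq₂).2.1
    rw [hι', mul_smul, inv_smul_smul] at h₃
    change u (f q) = _ at h₃
    rw [h₃, mul_inv_rev, inv_inv, inv_mul_cancel_right]

/-- The images of two components of `L` under translation by `K` are equal or disjoint, and they are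
open. -/
@[to_additive]
theorem surjective_smul_component [LocallyConnectedSpace L] (hι : Continuous ι)
    (hι' : ∀ (k : K) (l : L), ι (k • l) = k • ι l) (hs : ∀ l, HasLocalSlice K ι l)
    [ConnectedSpace Y] (l₀ : L) :
    Function.Surjective (fun q : K × ComponentOf τ l₀ => q.1 • ι q.2.val) := by
  have hopen : ∀ l, IsOpen (range fun q : K × ComponentOf τ l => q.1 • ι q.2.val) := fun l =>
    (isCoveringMap_smul_component hι hι' hs l).isOpenMap.isOpen_range
  have hmem : ∀ l, ι l ∈ range fun q : K × ComponentOf τ l => q.1 • ι q.2.val := fun l =>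
    ⟨(1, ⟨l, mem_connectedComponent⟩), one_smul _ _⟩
  have hclosed : IsClosed (range fun q : K × ComponentOf τ l₀ => q.1 • ι q.2.val) := by
    rw [← isOpen_compl_iff, isOpen_iff_mem_nhds]
    intro y hy
    obtain ⟨l, rfl⟩ := ι.surjective y
    filter_upwards [(hopen l).mem_nhds (hmem l)]
    rintro _ ⟨⟨k', x'⟩, rfl⟩ ⟨⟨k, x⟩, hx⟩
    apply hy
    change k • ι x.val = k' • ι x'.val at hx
    have hx' : k⁻¹ • k' • x'.val = x.val :=
      ι.injective (by rw [hι', hι', ← hx, inv_smul_smul])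
    have hl : k⁻¹ • k' • l ∈ connectedComponent l₀ := by
      have hxc : x.val ∈ connectedComponent l₀ := x.2
      rw [connectedComponent_eq hxc, ← hx', ← mul_smul, ← mul_smul]
      refine (isPreconnected_connectedComponent.image _
        (continuous_const_smul (k⁻¹ * k')).continuousOn).subset_connectedComponent
        (mem_image_of_mem _ x'.2) (mem_image_of_mem _ mem_connectedComponent)
    refine ⟨(k'⁻¹ * k, ⟨_, hl⟩), ?_⟩
    change (k'⁻¹ * k) • ι (k⁻¹ • k' • l) = ι l
    rw [hι', hι', mul_smul, smul_inv_smul, inv_smul_smul]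
  exact range_eq_univ.1 (IsClopen.eq_univ ⟨hclosed, hopen l₀⟩ ⟨_, hmem l₀⟩)

end Slices

/-! ### Lifting to covering spaces -/

/-- A connected covering space of a simply connected space is trivial. -/
theorem IsCoveringMap.isHomeomorph {E X : Type*} [TopologicalSpace E] [TopologicalSpace X]
    [ConnectedSpace E] [SimplyConnectedSpace X] [LocallyPathConnectedSpace X] {p : E → X}
    (hp : IsCoveringMap p) : IsHomeomorph p := by
  obtain ⟨e⟩ : Nonempty E := inferInstance
  obtain ⟨σ, ⟨hσ, hpσ⟩, -⟩ :=
    hp.existsUnique_continuousMap_lifts (ContinuousMap.id X) (p e) e rfl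
  have hσp : σ ∘ p = id :=
    hp.eq_of_comp_eq (σ.continuous.comp hp.continuous) continuous_id
      (by rw [← Function.comp_assoc, hpσ]; rfl) e hσ
  exact ⟨hp.continuous, hp.isOpenMap, (Function.LeftInverse.injective (congrFun hσp)),
    Function.RightInverse.surjective (congrFun hpσ)⟩

instance Prod.simplyConnectedSpace {X Y : Type*} [TopologicalSpace X] [TopologicalSpace Y]
    [SimplyConnectedSpace X] [SimplyConnectedSpace Y] : SimplyConnectedSpace (X × Y) := by
  refine simply_connected_iff_paths_homotopic.2 ⟨inferInstance, fun x y => ⟨fun p q => ?_⟩⟩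
  rw [← Path.Homotopic.prod_projLeft_projRight p, ← Path.Homotopic.prod_projLeft_projRight q]
  congr 1 <;> exact Subsingleton.elim _ _

/-- A flow on a locally path-connected space lifts to simply connected covering spaces. -/
theorem IsCoveringMap.exists_lift_flow {N M : Type*} [TopologicalSpace N] [TopologicalSpace M]
    [SimplyConnectedSpace N] [LocallyPathConnectedSpace N] {π : N → M} (hπ : IsCoveringMap π)
    (φ : Flow ℝ M) : ∃ ψ : Flow ℝ N, ∀ t z, π (ψ t z) = φ t (π z) := by
  obtain ⟨z₀⟩ : Nonempty N := inferInstance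
  obtain ⟨Φ, ⟨hΦ₀, hΦ⟩, -⟩ := hπ.existsUnique_continuousMap_lifts
    (A := ℝ × N) ⟨fun q => φ q.1 (π q.2), φ.continuous continuous_fst
      (hπ.continuous.comp continuous_snd)⟩ (0, z₀) z₀ (by simp)
  have hΦ' : ∀ t z, π (Φ (t, z)) = φ t (π z) := fun t z => congrFun hΦ (t, z)
  have hzero : ∀ z, Φ (0, z) = z := congrFun <| hπ.eq_of_comp_eq (g₁ := fun z => Φ (0, z))
    (g₂ := id) (by fun_prop) continuous_id (by ext z; simp [hΦ']) z₀ hΦ₀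
  have hadd : ∀ s t z, Φ (s + t, z) = Φ (s, Φ (t, z)) := by
    intro s t z
    -- both sides lift the same orbit in the time variable `s`
    exact congrFun (hπ.eq_of_comp_eq (g₁ := fun s => Φ (s + t, z))
      (g₂ := fun s => Φ (s, Φ (t, z))) (by fun_prop) (by fun_prop)
      (by ext s; simp [hΦ', φ.map_add]) 0 (by simp [hzero])) s
  exact ⟨⟨fun t z => Φ (t, z), Φ.continuous, hadd, hzero⟩, hΦ'⟩

section LiftedTopology

theorem IsLocalHomeomorph.locallyPathConnectedSpace {M N : Type*} [TopologicalSpace M]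
    [TopologicalSpace N] {π : N → M} [LocallyPathConnectedSpace M]
    (hπ : IsLocalHomeomorph π) : LocallyPathConnectedSpace N :=
  let _ : ChartedSpace M N :=
    { atlas := univ
      chartAt := fun z => (hπ z).choose
      mem_chart_source := fun z => (hπ z).choose_spec.1
      chart_mem_atlas := fun _ => mem_univ _ }
  ChartedSpace.locallyPathConnectedSpace M N

/-- The pullback along a local homeomorphism of a locally connected refinement of the topology of
the base is locally connected. The refinement is given by a bijection `ι : L ≃ M`, its pullback by
a bijection `j : P ≃ N`. -/
theorem IsLocalHomeomorph.locallyConnectedSpace_pullback {M N L P : Type*} [TopologicalSpace M]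
    [TopologicalSpace N] [TopologicalSpace L] [TopologicalSpace P] {π : N → M}
    (hπ : IsLocalHomeomorph π) {ι : L ≃ M} (hι : Continuous ι) {π' : P → L} {j : P ≃ N}
    (hj : ∀ z, 𝓝 z = comap j (𝓝 (j z)) ⊓ comap π' (𝓝 (π' z))) (hc : ∀ z, ι (π' z) = π (j z))
    [LocallyConnectedSpace L] : LocallyConnectedSpace P := by
  refine locallyConnectedSpace_of_connected_bases (fun _ s => s)
    (fun z s => s ∈ 𝓝 z ∧ IsPreconnected s) (fun z => ?_) (fun _ _ h => h.2)
  refine ⟨fun A => ⟨fun hA => ?_, fun ⟨s, hs, hsA⟩ => mem_of_superset hs.1 hsA⟩⟩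
  rw [hj, mem_inf_iff_superset] at hA
  obtain ⟨V', hV', D', hD', hVA⟩ := hA
  obtain ⟨V, hV, hVV'⟩ := mem_comap.1 hV'
  obtain ⟨D, hD, hDD'⟩ := mem_comap.1 hD'
  obtain ⟨e, hze, rfl⟩ := hπ (j z)
  -- a connected neighbourhood in `L` inside the sheet of `z`
  have hsheet : ι ⁻¹' (e '' (e.source ∩ V)) ∈ 𝓝 (π' z) := by
    refine hι.continuousAt.preimage_mem_nhds ?_
    rw [hc]
    exact e.image_mem_nhds hze (inter_mem (e.open_source.mem_nhds hze) hV)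
  obtain ⟨C, hCsub, hCo, hzC, hCc⟩ := locallyConnectedSpace_iff_subsets_isOpen_isConnected.1
    ‹_› (π' z) _ (inter_mem hsheet hD)
  have hCt : ∀ x ∈ C, ι x ∈ e.target ∧ e.symm (ι x) ∈ V := by
    intro x hx
    obtain ⟨y, hy, hyx⟩ := (hCsub hx).1
    rw [← hyx]
    exact ⟨e.map_source hy.1, by rw [e.left_inv hy.1]; exact hy.2⟩
  have hsec : ∀ x ∈ C, π' (j.symm (e.symm (ι x))) = x := fun x hx =>
    ι.injective (by rw [hc, j.apply_symm_apply, e.right_inv (hCt x hx).1])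
  refine ⟨(fun x => j.symm (e.symm (ι x))) '' C, ⟨?_, hCc.isPreconnected.image _ ?_⟩, ?_⟩
  · rw [hj]
    refine mem_of_superset (inter_mem_inf (preimage_mem_comap (e.open_source.mem_nhds hze))
      (preimage_mem_comap (hCo.mem_nhds hzC))) ?_
    rintro x ⟨hx, hxC⟩
    exact ⟨π' x, hxC, by dsimp only; rw [hc, e.left_inv hx, j.symm_apply_apply]⟩
  · intro x hx
    rw [ContinuousWithinAt, hj, tendsto_inf, tendsto_comap_iff, tendsto_comap_iff, hsec x hx]
    refine ⟨?_, ?_⟩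
    · simp only [Function.comp_def, Equiv.apply_symm_apply]
      exact ((e.continuousAt_symm (hCt x hx).1).tendsto.comp hι.continuousAt).mono_left inf_le_left
    · refine Tendsto.congr' ?_ (tendsto_id.mono_left inf_le_left)
      filter_upwards [self_mem_nhdsWithin] with x' hx'
      exact (hsec x' hx').symm
  · rintro _ ⟨x, hx, rfl⟩
    refine hVA ⟨hVV' ?_, hDD' ?_⟩
    · simpa using (hCt x hx).2
    · rw [mem_preimage, hsec x hx]
      exact (hCsub hx).2

variable {M N : Type*} {τ' : TopologicalSpace M} [τ : TopologicalSpace M] [σ : TopologicalSpace N]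
  {π : N → M}

/-- Local slices lift to covering spaces. -/
theorem HasLocalVAddSlice.lift (hπ : Continuous π) {φ : Flow ℝ M} {ψ : Flow ℝ N}
    (hψ : ∀ t z, π (ψ t z) = φ t (π z)) {z : N}
    (h : @HasLocalVAddSlice ℝ _ _ M M τ τ' φ.toAddAction (Equiv.refl M) (π z)) :
    @HasLocalVAddSlice ℝ _ _ N N σ (σ ⊓ τ'.induced π) ψ.toAddAction (Equiv.refl N) z := by
  obtain ⟨B, W, Q, w, hB, hW, hlQ, hQ, hw, hwl, hwQ, huniq⟩ := h
  refine ⟨π ⁻¹' B, W, π ⁻¹' Q, w ∘ π, hπ.continuousAt hB, hW, hlQ, fun q hq => ?_,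
    hw.comp hπ.continuousOn (mapsTo_preimage π B), hwl, fun m hm => ?_, fun m hm k hk hkm => ?_⟩
  · have hq' := hQ (π q) hq
    rw [nhds_inf, @nhds_induced _ _ τ', hq']
    simp only [Equiv.coe_refl, comap_id, comap_inf, comap_principal, id_eq, ← inf_assoc]
    rw [inf_eq_left.2 hπ.continuousAt.le_comap]
  · have := hwQ (π m) hm
    change φ _ _ ∈ Q at this
    change π (ψ _ _) ∈ Q
    rw [hψ]
    exact this
  · refine huniq (π m) hm k hk ?_
    change π (ψ _ _) ∈ Q at hkm
    rw [hψ] at hkm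
    exact hkm

/-- Let `τ'` be a locally connected topology on `M`, finer than the given one and preserved by a
flow with local slices. On a simply connected covering space of `M`, the lifted flow
makes the space the product of the line and of any component of the lifted topology. -/
theorem exists_lift_flow_isHomeomorph [LocallyPathConnectedSpace M] [SimplyConnectedSpace N]
    (hτ : τ' ≤ τ) (hc : @LocallyConnectedSpace M τ') (hπ : IsCoveringMap π) {φ : Flow ℝ M}
    (hφ : ∀ t, @Continuous M M τ' τ' (φ t))
    (hs : ∀ x, @HasLocalVAddSlice ℝ _ _ M M τ τ' φ.toAddAction (Equiv.refl M) x) :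
    ∃ ψ : Flow ℝ N, (∀ t z, π (ψ t z) = φ t (π z)) ∧ ∀ z₀ : N,
      IsHomeomorph (fun q : ℝ × ComponentOf (σ ⊓ τ'.induced π) z₀ => ψ q.1 q.2.val) ∧
      ∀ t : ℝ, ψ t '' (@connectedComponent N (σ ⊓ τ'.induced π) z₀) =
        @connectedComponent N (σ ⊓ τ'.induced π) (ψ t z₀) := by
  have := hπ.isLocalHomeomorph.locallyPathConnectedSpace
  obtain ⟨ψ, hψ⟩ := hπ.exists_lift_flow φ
  have hψc : ∀ t, @Continuous N N (σ ⊓ τ'.induced π) (σ ⊓ τ'.induced π) (ψ t) := by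
    intro t
    rw [continuous_inf_rng]
    refine ⟨continuous_inf_dom_left (ψ.continuous_toFun t), ?_⟩
    refine continuous_inf_dom_right (continuous_induced_rng.2 ?_)
    have : π ∘ ψ t = φ t ∘ π := funext (hψ t)
    rw [this]
    exact @Continuous.comp _ _ _ (τ'.induced π) τ' τ' _ _ (hφ t) continuous_induced_dom
  refine ⟨ψ, hψ, fun z₀ => ⟨?_, fun t => ?_⟩⟩
  · let _ : AddAction ℝ N := ψ.toAddAction
    have : ContinuousVAdd ℝ N := ⟨ψ.cont'⟩
    have : @ContinuousConstVAdd ℝ N (σ ⊓ τ'.induced π) _ := @ContinuousConstVAdd.mk _ _ (_) _ hψc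
    have hloc : @LocallyConnectedSpace N (σ ⊓ τ'.induced π) :=
      @IsLocalHomeomorph.locallyConnectedSpace_pullback M N M N τ σ τ' (σ ⊓ τ'.induced π) π
        hπ.isLocalHomeomorph (Equiv.refl M) (continuous_id_iff_le.2 hτ) π (Equiv.refl N)
        (fun z => by
          rw [nhds_inf, @nhds_induced _ _ τ']
          simp only [Equiv.coe_refl, comap_id, id_eq]) (fun _ => rfl) hc
    have hcov := @isCoveringMap_vadd_component ℝ _ _ _ N N σ (σ ⊓ τ'.induced π) _ _
      (Equiv.refl N) _ _ hloc
      (continuous_inf_dom_left continuous_id) (fun _ _ => rfl)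
      (fun z => (hs (π z)).lift hπ.continuous hψ) z₀
    have : ConnectedSpace (ComponentOf (σ ⊓ τ'.induced π) z₀) :=
      @isConnected_iff_connectedSpace N (σ ⊓ τ'.induced π) _ |>.1
        (@isConnected_connectedComponent N (σ ⊓ τ'.induced π) z₀)
    exact hcov.isHomeomorph
  · refine Subset.antisymm
      (@Continuous.image_connectedComponent_subset N N (_) (_) _ (hψc t) z₀) fun z hz => ?_
    have h := (@Continuous.image_connectedComponent_subset N N (_) (_) _ (hψc (-t)) (ψ t z₀))
      (mem_image_of_mem (ψ (-t)) hz)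
    rw [← ψ.map_add, neg_add_cancel, ψ.map_zero_apply] at h
    exact ⟨_, h, by rw [← ψ.map_add, add_neg_cancel, ψ.map_zero_apply]⟩

end LiftedTopology

/-! ### Leaves and tangent spaces of a foliation -/

namespace Foliation

variable {E : Type*} [NormedAddCommGroup E] [NormedSpace ℝ E]
  {H : Type*} [TopologicalSpace H] {I : ModelWithCorners ℝ E H}
  {M : Type*} [TopologicalSpace M] [ChartedSpace H M]
  {F : Type*} [NormedAddCommGroup F] [NormedSpace ℝ F]
  {G : Type*} [NormedAddCommGroup G] [NormedSpace ℝ G]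
  (𝓕 : Foliation I M F G) {κ κ' : OpenPartialHomeomorph M (F × G)}

/-- On a plaque, the leaf topology is the topology induced by that of `M`: by compatibility of the
charts, another plaque through `x` contains all points of the given one near `x`. -/
theorem nhds_leafTopology (hκ : κ ∈ 𝓕.charts) {x : M} (hx : x ∈ κ.source) :
    @nhds M 𝓕.leafTopology x = 𝓝 x ⊓ 𝓟 (plaque κ (κ x).2) := by
  rw [TopologicalSpace.nhds_generateFrom]
  refine le_antisymm (le_inf (fun A hA => ?_) ?_) (le_iInf₂ ?_)
  · obtain ⟨V, hVA, hV, hxV⟩ := mem_nhds_iff.1 hA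
    refine mem_of_superset (mem_iInf_of_mem (V ∩ plaque κ (κ x).2) (mem_iInf_of_mem ?_
      (mem_principal_self _))) (inter_subset_left.trans hVA)
    exact ⟨⟨hxV, hx, rfl⟩, V, hV, κ, hκ, _, rfl⟩
  · refine iInf₂_le_of_le (κ.source ∩ plaque κ (κ x).2) ?_
      (principal_mono.2 inter_subset_right)
    exact ⟨⟨hx, hx, rfl⟩, κ.source, κ.open_source, κ, hκ, _, rfl⟩
  · intro s hs
    obtain ⟨hxs, V, hV, κ', hκ', c, rfl⟩ := hs
    obtain ⟨hxV, hx', hxc⟩ := hxs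
    obtain ⟨U, hU, hUc⟩ := 𝓕.compatible κ hκ κ' hκ' x ⟨hx, hx'⟩
    rw [le_principal_iff, mem_inf_principal]
    filter_upwards [hU, hV.mem_nhds hxV, κ'.open_source.mem_nhds hx'] with y hyU hyV hy' hy
    exact ⟨hyV, hy', (hUc y hyU x (mem_of_mem_nhds hU) hy.2).trans hxc⟩

theorem leafTopology_le : 𝓕.leafTopology ≤ ‹TopologicalSpace M› := by
  refine le_of_nhds_le_nhds fun x => ?_
  obtain ⟨κ, hκ, hx⟩ := 𝓕.cover x
  rw [𝓕.nhds_leafTopology hκ hx]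
  exact inf_le_left

theorem locallyPathConnectedSpace (𝓕 : Foliation I M F G) : LocallyPathConnectedSpace M := by
  choose κ hκ hx using 𝓕.cover
  let _ : ChartedSpace (F × G) M :=
    { atlas := univ
      chartAt := κ
      mem_chart_source := hx
      chart_mem_atlas := fun _ => mem_univ _ }
  exact ChartedSpace.locallyPathConnectedSpace (F × G) M

/-- Small balls in the plaques form a basis of connected neighbourhoods for the leaf topology. -/
theorem locallyConnectedSpace_leafTopology : @LocallyConnectedSpace M 𝓕.leafTopology := by
  refine @locallyConnectedSpace_of_connected_bases M 𝓕.leafTopology (Set M) (fun _ s => s)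
    (fun x s => s ∈ @nhds M 𝓕.leafTopology x ∧ @IsPreconnected M 𝓕.leafTopology s) (fun x => ?_)
    (fun _ _ h => h.2)
  refine ⟨fun A => ⟨fun hA => ?_, fun ⟨s, hs, hsA⟩ => mem_of_superset hs.1 hsA⟩⟩
  obtain ⟨κ, hκ, hx⟩ := 𝓕.cover x
  have hnhds := 𝓕.nhds_leafTopology hκ hx
  rw [hnhds, mem_inf_principal] at hA
  set c := (κ x).2 with hc
  have hA' : {p | p ∈ κ.target ∧ (κ.symm p ∈ plaque κ c → κ.symm p ∈ A)} ∈ 𝓝 (κ x) := by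
    refine inter_mem (κ.open_target.mem_nhds (κ.map_source hx)) ?_
    refine (κ.continuousAt_symm (κ.map_source hx)).eventually
      (p := fun y => y ∈ plaque κ c → y ∈ A) ?_
    rw [κ.left_inv hx]
    exact hA
  obtain ⟨r, hr, hball⟩ := Metric.mem_nhds_iff.1 hA'
  have hmem : ∀ v ∈ Metric.ball (κ x).1 r, (v, c) ∈ Metric.ball (κ x) r := by
    intro v hv
    rw [← ball_prod_same]
    exact ⟨hv, Metric.mem_ball_self hr⟩
  have hpl : ∀ v ∈ Metric.ball (κ x).1 r, κ.symm (v, c) ∈ plaque κ c := by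
    intro v hv
    have := (hball (hmem v hv)).1
    exact ⟨κ.map_target this, by rw [κ.right_inv this]⟩
  refine ⟨(fun v => κ.symm (v, c)) '' Metric.ball (κ x).1 r, ⟨?_, ?_⟩, ?_⟩
  · rw [hnhds, mem_inf_principal]
    filter_upwards [κ.open_source.mem_nhds hx,
      (κ.continuousAt hx).preimage_mem_nhds (Metric.ball_mem_nhds _ hr)] with y hy hyr hyc
    refine ⟨(κ y).1, ?_, ?_⟩
    · rw [mem_preimage, ← ball_prod_same] at hyr
      exact hyr.1
    · have : ((κ y).1, c) = κ y := Prod.ext rfl hyc.2.symm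
      simp only [this, κ.left_inv hy]
  · refine @IsPreconnected.image F M _ 𝓕.leafTopology _
      (convex_ball _ _).isPreconnected _ fun v hv => ?_
    have hv' := hpl v hv
    have hn := 𝓕.nhds_leafTopology hκ hv'.1
    rw [hv'.2] at hn
    rw [@ContinuousWithinAt.eq_def, hn, tendsto_inf, tendsto_principal]
    refine ⟨?_, ?_⟩
    · have h₁ : ContinuousAt (fun v : F => κ.symm (v, c)) v :=
        ContinuousAt.comp (f := fun v : F => (v, c)) (κ.continuousAt_symm (hball (hmem v hv)).1)
          (by fun_prop)
      exact h₁.continuousWithinAt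
    · filter_upwards [self_mem_nhdsWithin] with v' hv'
      exact hpl v' hv'
  · rintro _ ⟨v, hv, rfl⟩
    exact (hball (hmem v hv)).2 (hpl v hv)

variable {𝓕}

theorem mdifferentiableAt_chart (hκ : κ ∈ 𝓕.charts) {x : M} (hx : x ∈ κ.source) :
    MDifferentiableAt I 𝓘(ℝ, F × G) κ x :=
  ((𝓕.contMDiffOn_chart κ hκ).contMDiffAt (κ.open_source.mem_nhds hx)).mdifferentiableAt
    (by simp)

theorem mdifferentiableAt_symm (hκ : κ ∈ 𝓕.charts) {p : F × G} (hp : p ∈ κ.target) :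
    MDifferentiableAt 𝓘(ℝ, F × G) I κ.symm p :=
  ((𝓕.contMDiffOn_symm κ hκ).contMDiffAt (κ.open_target.mem_nhds hp)).mdifferentiableAt
    (by simp)

theorem hasMFDerivAt_chart_snd (hκ : κ ∈ 𝓕.charts) {x : M} (hx : x ∈ κ.source) :
    HasMFDerivAt I 𝓘(ℝ, G) (fun y => (κ y).2) x
      ((ContinuousLinearMap.snd ℝ F G).comp (mfderiv I 𝓘(ℝ, F × G) κ x)) :=
  HasMFDerivAt.comp x (hasFDerivAt_snd (𝕜 := ℝ) (p := κ x)).hasMFDerivAt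
    (mdifferentiableAt_chart hκ hx).hasMFDerivAt

theorem mdifferentiable_chart (hκ : κ ∈ 𝓕.charts) : κ.MDifferentiable I 𝓘(ℝ, F × G) :=
  ⟨(𝓕.contMDiffOn_chart κ hκ).mdifferentiableOn (by simp),
    (𝓕.contMDiffOn_symm κ hκ).mdifferentiableOn (by simp)⟩

theorem hasMFDerivAt_slice (hκ : κ ∈ 𝓕.charts) {v : F} {c : G} (hp : (v, c) ∈ κ.target) :
    HasMFDerivAt 𝓘(ℝ, F) I (fun v' => κ.symm (v', c)) v
      ((mfderiv 𝓘(ℝ, F × G) I κ.symm (v, c)).comp (ContinuousLinearMap.inl ℝ F G)) :=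
  HasMFDerivAt.comp (f := fun v' : F => (v', c)) v (mdifferentiableAt_symm hκ hp).hasMFDerivAt
    (hasFDerivAt_prodMk_left (𝕜 := ℝ) v c).hasMFDerivAt

theorem mfderiv_chart_snd_slice (hκ : κ ∈ 𝓕.charts) {v : F} {c : G} (hp : (v, c) ∈ κ.target)
    (w : F) : mfderiv I 𝓘(ℝ, G) (fun y => (κ y).2) (κ.symm (v, c))
      (mfderiv 𝓘(ℝ, F × G) I κ.symm (v, c) (w, 0)) = 0 := by
  rw [(hasMFDerivAt_chart_snd hκ (κ.map_target hp)).mfderiv]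
  have h := (mdifferentiable_chart hκ).comp_symm_deriv hp
  exact congrArg Prod.snd (DFunLike.congr_fun h ((w, 0) : F × G))

/-- The differential of the transverse coordinate of a chart vanishes on the kernel of the
differential of the transverse coordinate of another one, as the former coordinate is constant on
the plaques of the latter. -/
theorem mfderiv_chart_snd_eq_zero (hκ : κ ∈ 𝓕.charts) (hκ' : κ' ∈ 𝓕.charts) {x : M}
    (hx : x ∈ κ.source) (hx' : x ∈ κ'.source) {u : TangentSpace I x}
    (hu : mfderiv I 𝓘(ℝ, G) (fun y => (κ y).2) x u = 0) :
    mfderiv I 𝓘(ℝ, G) (fun y => (κ' y).2) x u = 0 := by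
  obtain ⟨U, hU, hUc⟩ := 𝓕.compatible κ hκ κ' hκ' x ⟨hx, hx'⟩
  have hp := κ.map_source hx
  have hxp := κ.left_inv hx
  set v := (κ x).1 with hv
  set c := (κ x).2 with hc
  have hvc : κ x = (v, c) := rfl
  rw [hvc] at hp hxp
  rw [(hasMFDerivAt_chart_snd hκ hx).mfderiv] at hu
  have hu' : mfderiv I 𝓘(ℝ, F × G) κ x u = ((mfderiv I 𝓘(ℝ, F × G) κ x u : F × G).1, (0 : G)) :=
    Prod.ext rfl hu
  have hslice := hasMFDerivAt_slice hκ hp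
  have hcomp := HasMFDerivAt.comp (f := fun v' => κ.symm (v', c))
    (g := fun y => (κ' y).2) v (by
      rw [hxp]
      exact (hasMFDerivAt_chart_snd hκ' hx').mdifferentiableAt.hasMFDerivAt) hslice
  have hconst : ∀ᶠ v' in 𝓝 v, (κ' (κ.symm (v', c))).2 = (κ' x).2 := by
    have hcont : ContinuousAt (fun v' : F => κ.symm (v', c)) v := hslice.continuousAt
    have e₁ : ∀ᶠ v' in 𝓝 v, κ.symm (v', c) ∈ U := hcont (by simpa only [hxp] using hU)
    have e₂ : ∀ᶠ v' in 𝓝 v, (v', c) ∈ κ.target :=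
      (by fun_prop : ContinuousAt (fun v' : F => (v', c)) v) (κ.open_target.mem_nhds hp)
    filter_upwards [e₁, e₂] with v' h₁ h₂
    exact hUc _ h₁ _ (mem_of_mem_nhds hU) (by rw [κ.right_inv h₂])
  have h0 := hasMFDerivAt_unique hcomp
    ((hasMFDerivAt_const (I := 𝓘(ℝ, F)) (I' := 𝓘(ℝ, G)) ((κ' x).2) v).congr_of_eventuallyEq hconst)
  have h := (mdifferentiable_chart hκ).symm_comp_deriv hx
  have h₁ : mfderiv 𝓘(ℝ, F × G) I κ.symm (v, c) (mfderiv I 𝓘(ℝ, F × G) κ x u) = u :=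
    DFunLike.congr_fun h u
  rw [hu'] at h₁
  have h₂ := DFunLike.congr_fun h0 (mfderiv I 𝓘(ℝ, F × G) κ x u : F × G).1
  rw [← h₁]
  exact h₂

theorem mem_tangentSpace_iff (hκ : κ ∈ 𝓕.charts) {x : M} (hx : x ∈ κ.source)
    {u : TangentSpace I x} :
    u ∈ 𝓕.tangentSpace x ↔ mfderiv I 𝓘(ℝ, G) (fun y => (κ y).2) x u = 0 := by
  simp only [tangentSpace, Submodule.mem_iInf, LinearMap.mem_ker]
  exact ⟨fun h => h κ hκ hx, fun h κ' hκ' hx' => mfderiv_chart_snd_eq_zero hκ hκ' hx hx' h⟩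

theorem surjective_mfderiv_chart_snd (hκ : κ ∈ 𝓕.charts) {x : M} (hx : x ∈ κ.source) :
    Function.Surjective (mfderiv I 𝓘(ℝ, G) (fun y => (κ y).2) x) := by
  intro c
  rw [(hasMFDerivAt_chart_snd hκ hx).mfderiv]
  refine ⟨mfderiv 𝓘(ℝ, F × G) I κ.symm (κ x) ((0, c) : F × G), ?_⟩
  have h := (mdifferentiable_chart hκ).symm.symm_comp_deriv (κ.map_source hx)
  rw [κ.symm_symm, κ.left_inv hx] at h
  exact congrArg Prod.snd (DFunLike.congr_fun h ((0, c) : F × G))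

/-- A differentiable map whose differential preserves the tangent spaces of the leaves is continuous
for the leaf topology: in charts, the transverse coordinate of the image has zero derivative
along plaques, hence is locally constant on them. -/
theorem IsPreservedBy.continuous_leafTopology {f : M → M} (hf : 𝓕.IsPreservedBy f)
    (hd : ∀ x, MDifferentiableAt I I f x) :
    @Continuous M M 𝓕.leafTopology 𝓕.leafTopology f := by
  have hfc : Continuous f := continuous_iff_continuousAt.2 fun x => (hd x).continuousAt
  refine (@continuous_iff_continuousAt M M 𝓕.leafTopology 𝓕.leafTopology f).2 fun x => ?_
  obtain ⟨κ, hκ, hx⟩ := 𝓕.cover x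
  obtain ⟨κ', hκ', hx'⟩ := 𝓕.cover (f x)
  unfold ContinuousAt
  rw [𝓕.nhds_leafTopology hκ hx, 𝓕.nhds_leafTopology hκ' hx', tendsto_inf, tendsto_principal]
  refine ⟨hfc.continuousAt.tendsto.mono_left inf_le_left, ?_⟩
  rw [eventually_inf_principal]
  have hp := κ.map_source hx
  set v := (κ x).1 with hv
  set c := (κ x).2 with hc
  -- a ball in the plaque which is mapped into the domain of `κ'`
  have hA : {p | p ∈ κ.target ∧ f (κ.symm p) ∈ κ'.source} ∈ 𝓝 (κ x) := by
    refine inter_mem (κ.open_target.mem_nhds hp) ?_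
    refine (hfc.continuousAt.comp (κ.continuousAt_symm hp)).preimage_mem_nhds ?_
    rw [Function.comp_apply, κ.left_inv hx]
    exact κ'.open_source.mem_nhds hx'
  obtain ⟨r, hr, hball⟩ := Metric.mem_nhds_iff.1 hA
  have hmem : ∀ v' ∈ Metric.ball v r, (v', c) ∈ Metric.ball (κ x) r := by
    intro v' hv'
    rw [← ball_prod_same]
    exact ⟨hv', Metric.mem_ball_self hr⟩
  let g : F → G := fun v' => (κ' (f (κ.symm (v', c)))).2
  have hg : ∀ v' ∈ Metric.ball v r, HasFDerivAt g (0 : F →L[ℝ] G) v' := by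
    intro v' hv'
    obtain ⟨ht, hs⟩ := hball (hmem v' hv')
    have h₁ := hasMFDerivAt_slice hκ ht
    have h₂ := HasMFDerivAt.comp (f := fun v' => κ.symm (v', c)) v' (hd _).hasMFDerivAt h₁
    have h₃ := HasMFDerivAt.comp (f := f ∘ fun v' => κ.symm (v', c)) v'
      (hasMFDerivAt_chart_snd hκ' hs).mdifferentiableAt.hasMFDerivAt h₂
    have h₄ := hasMFDerivAt_iff_hasFDerivAt.1 h₃
    refine h₄.congr_fderiv (ContinuousLinearMap.ext fun w => ?_)
    have hT := (mem_tangentSpace_iff hκ (κ.map_target ht)).2 (mfderiv_chart_snd_slice hκ ht w)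
    have hT' := Submodule.mem_map_of_mem
      (f := (mfderiv I I f (κ.symm (v', c))).toLinearMap) hT
    rw [hf] at hT'
    exact (mem_tangentSpace_iff hκ' hs).1 hT'
  have hgc : ∀ v' ∈ Metric.ball v r, g v' = g v := fun v' hv' =>
    (convex_ball v r).is_const_of_fderivWithin_eq_zero (𝕜 := ℝ)
      (fun y hy => (hg y hy).differentiableAt.differentiableWithinAt)
      (fun y hy => by
        rw [fderivWithin_of_isOpen Metric.isOpen_ball hy, (hg y hy).fderiv])
      hv' (Metric.mem_ball_self hr)
  filter_upwards [κ.open_source.mem_nhds hx, hfc.continuousAt (κ'.open_source.mem_nhds hx'),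
    (κ.continuousAt hx).preimage_mem_nhds (Metric.ball_mem_nhds _ hr)] with y hy hfy hyr hyc
  refine ⟨hfy, ?_⟩
  rw [mem_preimage, ← ball_prod_same] at hyr
  have h := hgc _ hyr.1
  have hy' : ((κ y).1, c) = κ y := Prod.ext rfl hyc.2.symm
  have hx'' : (v, c) = κ x := rfl
  simp only [g, hy', hx'', κ.left_inv hy, κ.left_inv hx] at h
  exact h

end Foliation

/-! ### An implicit function theorem with a topological parameter -/

/-- Solve `θ z b = θ z₀ a₀` for `b = a z` near `a₀`, when `θ z` is, near `a₀` and uniformly in the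
parameter `z`, well approximated by an invertible linear map. Only continuity in the
parameter `z` is required, and the solution is continuous in `z`. -/
theorem exists_continuousOn_implicit {Z V G : Type*} [TopologicalSpace Z] [NormedAddCommGroup V]
    [NormedSpace ℝ V] [CompleteSpace V] [NormedAddCommGroup G] [NormedSpace ℝ G]
    {θ : Z → V → G} {z₀ : Z} {a₀ : V} (A : V ≃L[ℝ] G)
    (happ : ∀ c : NNReal, 0 < c → ∃ r > 0, ∀ᶠ z in 𝓝 z₀,
      ApproximatesLinearOn (θ z) (A : V →L[ℝ] G) (Metric.ball a₀ r) c)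
    {Ω : Set (Z × V)} (hΩ : Ω ∈ 𝓝 (z₀, a₀))
    (hcont : ∀ p ∈ Ω, ContinuousAt (fun z => θ z p.2) p.1) :
    ∃ U ∈ 𝓝 z₀, ∃ r > 0, ∃ a : Z → V, ContinuousOn a U ∧ a z₀ = a₀ ∧
      ∀ z ∈ U, (∀ b ∈ Metric.ball a₀ r, (z, b) ∈ Ω) ∧ a z ∈ Metric.ball a₀ r ∧
        θ z (a z) = θ z₀ a₀ ∧ ∀ b ∈ Metric.ball a₀ r, θ z b = θ z₀ a₀ → b = a z := by
  -- with error `1 / (2 * N)`, where `N` bounds the inverse of `A`, the maps `θ z` are invertible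
  set N : NNReal := ‖(A.symm : G →L[ℝ] V)‖₊ + 1 with hN
  have hN0 : 0 < N := by positivity
  set c : NNReal := (2 * N)⁻¹ with hc
  have hc0 : 0 < c := by positivity
  have hcN : (N : ℝ) * c = 1 / 2 := by
    rw [hc]; push_cast; field_simp
  obtain ⟨r₁, hr₁, happ₁⟩ := happ c hc0
  rw [nhds_prod_eq, mem_prod_iff] at hΩ
  obtain ⟨U₁, hU₁, D, hD, hUD⟩ := hΩ
  obtain ⟨r₂, hr₂, hball⟩ := Metric.mem_nhds_iff.1 hD
  set r := min r₁ r₂ with hr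
  have hr0 : 0 < r := lt_min hr₁ hr₂
  have hinv : ∀ g, ‖A.symm g‖ ≤ N * ‖g‖ := fun g => by
    refine ((A.symm : G →L[ℝ] V).le_opNorm g).trans ?_
    gcongr
    rw [hN]
    push_cast
    linarith
  let R : (A : V →L[ℝ] G).NonlinearRightInverse :=
    { toFun := A.symm
      nnnorm := N
      bound' := hinv
      right_inv' := A.apply_symm_apply }
  -- the maps `θ z` are expanding near `a₀`
  have hexp : ∀ z, ApproximatesLinearOn (θ z) (A : V →L[ℝ] G) (Metric.ball a₀ r₁) c →
      ∀ b ∈ Metric.ball a₀ r, ∀ b' ∈ Metric.ball a₀ r, ‖b - b'‖ ≤ 2 * N * ‖θ z b - θ z b'‖ := by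
    intro z hz b hb b' hb'
    have h₁ := hz b (Metric.ball_subset_ball (min_le_left _ _) hb) b'
      (Metric.ball_subset_ball (min_le_left _ _) hb')
    have h₂ : ‖b - b'‖ ≤ N * ‖A (b - b')‖ := by simpa using hinv (A (b - b'))
    have h₃ : ‖A (b - b')‖ ≤ ‖θ z b - θ z b'‖ + ‖θ z b - θ z b' - A (b - b')‖ := by
      have := norm_sub_le (θ z b - θ z b') (θ z b - θ z b' - A (b - b'))
      rwa [sub_sub_cancel] at this
    have h₄ : ‖b - b'‖ ≤ N * (‖θ z b - θ z b'‖ + c * ‖b - b'‖) :=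
      h₂.trans (by gcongr; exact h₃.trans (by gcongr; exact h₁))
    have h₅ : (N : ℝ) * (c * ‖b - b'‖) = ‖b - b'‖ / 2 := by rw [← mul_assoc, hcN]; ring
    rw [mul_add, h₅] at h₄
    linarith
  have hθ : ∀ᶠ z in 𝓝 z₀, θ z₀ a₀ ∈ Metric.closedBall (θ z a₀) (((N : ℝ)⁻¹ - c) * (r / 2)) := by
    have hpos : 0 < ((N : ℝ)⁻¹ - c) * (r / 2) := by
      have : (c : ℝ) < (N : ℝ)⁻¹ := by
        rw [lt_inv_comm₀ (by positivity) (by positivity), hc]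
        push_cast
        rw [inv_inv]
        have : (0 : ℝ) < N := by exact_mod_cast hN0
        linarith
      have : 0 < (N : ℝ)⁻¹ - c := sub_pos.2 this
      positivity
    have h := hcont (z₀, a₀) (hUD ⟨mem_of_mem_nhds hU₁, mem_of_mem_nhds hD⟩)
    filter_upwards [h (Metric.closedBall_mem_nhds _ hpos)] with z hz
    rw [Metric.mem_closedBall, dist_comm]
    exact hz
  set U := U₁ ∩ {z | ApproximatesLinearOn (θ z) (A : V →L[ℝ] G) (Metric.ball a₀ r₁) c ∧
    θ z₀ a₀ ∈ Metric.closedBall (θ z a₀) (((N : ℝ)⁻¹ - c) * (r / 2))} with hU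
  have hUmem : U ∈ 𝓝 z₀ := inter_mem hU₁ (happ₁.and hθ)
  have hex : ∀ z, ∃ b, z ∈ U → b ∈ Metric.ball a₀ r ∧ θ z b = θ z₀ a₀ := by
    intro z
    by_cases hz : z ∈ U
    · have hsub : Metric.closedBall a₀ (r / 2) ⊆ Metric.ball a₀ r :=
        Metric.closedBall_subset_ball (by linarith)
      obtain ⟨b, hb, hb'⟩ := hz.2.1.surjOn_closedBall_of_nonlinearRightInverse R
        (b := a₀) (ε := r / 2) (by positivity)
        (hsub.trans (Metric.ball_subset_ball (min_le_left _ _))) hz.2.2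
      exact ⟨b, fun _ => ⟨hsub hb, hb'⟩⟩
    · exact ⟨a₀, fun h => (hz h).elim⟩
  choose a ha using hex
  have huniq : ∀ z ∈ U, ∀ b ∈ Metric.ball a₀ r, θ z b = θ z₀ a₀ → b = a z := by
    intro z hz b hb hbz
    have h := hexp z hz.2.1 b hb (a z) (ha z hz).1
    rw [hbz, (ha z hz).2, sub_self, norm_zero, mul_zero] at h
    exact sub_eq_zero.1 (norm_le_zero_iff.1 h)
  have hΩ' : ∀ z ∈ U, ∀ b ∈ Metric.ball a₀ r, (z, b) ∈ Ω := fun z hz b hb =>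
    hUD ⟨hz.1, hball (Metric.ball_subset_ball (min_le_right _ _) hb)⟩
  refine ⟨U, hUmem, r, hr0, a, fun z hz => ?_, ?_, fun z hz => ⟨hΩ' z hz, (ha z hz).1, (ha z hz).2,
    huniq z hz⟩⟩
  · have hcz : ContinuousAt (fun z' => θ z' (a z)) z := hcont _ (hΩ' z hz _ (ha z hz).1)
    rw [ContinuousWithinAt, tendsto_iff_norm_sub_tendsto_zero]
    have hlim : Tendsto (fun z' => 2 * N * ‖θ z₀ a₀ - θ z' (a z)‖) (𝓝[U] z) (𝓝 0) := by
      have h := ((continuousAt_const (y := θ z₀ a₀)).sub hcz).norm.const_mul (2 * (N : ℝ))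
      simp only [ContinuousAt, Pi.sub_apply, (ha z hz).2, sub_self, norm_zero, mul_zero] at h
      exact h.mono_left nhdsWithin_le_nhds
    refine squeeze_zero' (Eventually.of_forall fun _ => norm_nonneg _) ?_ hlim
    filter_upwards [self_mem_nhdsWithin] with z' hz'
    have h := hexp z' hz'.2.1 (a z') (ha z' hz').1 (a z) (ha z hz).1
    rwa [(ha z' hz').2] at h
  · exact (huniq z₀ (mem_of_mem_nhds hUmem) a₀ (Metric.mem_ball_self hr0) rfl).symm

/-! ### Slices for transverse flows -/

namespace Foliation

variable {E : Type*} [NormedAddCommGroup E] [NormedSpace ℝ E]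
  {H : Type*} [TopologicalSpace H] {I : ModelWithCorners ℝ E H}
  {M : Type*} [TopologicalSpace M] [ChartedSpace H M] [IsManifold I ∞ M]
  {F : Type*} [NormedAddCommGroup F] [NormedSpace ℝ F]

section

variable {G : Type*} [NormedAddCommGroup G] [NormedSpace ℝ G]
  {𝓕 : Foliation I M F G} {κ : OpenPartialHomeomorph M (F × G)}

theorem continuousOn_mfderiv_chart_snd_apply (hκ : κ ∈ 𝓕.charts) {X : ∀ x : M, TangentSpace I x}
    (hX : Continuous fun x => (⟨x, X x⟩ : TangentBundle I M)) :
    ContinuousOn (fun x => (mfderiv I 𝓘(ℝ, G) (fun y => (κ y).2) x (X x) : G)) κ.source := by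
  have h₁ : ContMDiffOn I 𝓘(ℝ, G) ∞ (fun y => (κ y).2) κ.source :=
    contDiff_snd.contMDiff.comp_contMDiffOn (𝓕.contMDiffOn_chart κ hκ)
  have h₂ := (h₁.continuousOn_tangentMapWithin (by simp) κ.open_source.uniqueMDiffOn).comp
    hX.continuousOn (fun x hx => hx)
  have h₃ := (contMDiff_snd_tangentBundle_modelSpace G 𝓘(ℝ, G) (n := 0)).continuous.comp_continuousOn h₂
  refine h₃.congr fun x hx => ?_
  change _ = mfderivWithin I 𝓘(ℝ, G) (fun y => (κ y).2) κ.source x (X x)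
  rw [mfderivWithin_of_isOpen κ.open_source hx]

end

/-- A flow whose orbits are transverse to a foliation of codimension one has local slices: the
plaques of the foliated charts. -/
theorem hasLocalVAddSlice_flow (𝓕 : Foliation I M F ℝ) {X : ∀ x : M, TangentSpace I x}
    (hX : Continuous fun x => (⟨x, X x⟩ : TangentBundle I M)) (hX₀ : ∀ x, X x ≠ 0)
    {φ : Flow ℝ M} (hφ : ∀ x, IsMIntegralCurve (I := I) (fun t => φ t x) X)
    (hT : ∀ x, IsCompl (Submodule.span ℝ {X x}) (𝓕.tangentSpace x)) (x : M) :
    @HasLocalVAddSlice ℝ _ _ M M _ 𝓕.leafTopology φ.toAddAction (Equiv.refl M) x := by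
  obtain ⟨κ, hκ, hx⟩ := 𝓕.cover x
  -- the speed at which the flow crosses the plaques
  set s : M → ℝ := fun y => mfderiv I 𝓘(ℝ, ℝ) (fun y => (κ y).2) y (X y) with hs
  have hsc : ContinuousOn s κ.source := continuousOn_mfderiv_chart_snd_apply hκ hX
  have hs₀ : s x ≠ 0 := fun h => hX₀ x <| by
    have h₁ := (mem_tangentSpace_iff hκ hx).2 h
    exact (Submodule.disjoint_def.1 (hT x).disjoint) _ (Submodule.mem_span_singleton_self _) h₁
  let A : ℝ ≃L[ℝ] ℝ := ContinuousLinearEquiv.unitsEquivAut ℝ (Units.mk0 _ hs₀)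
  have hder : ∀ m t, φ t m ∈ κ.source →
      HasFDerivAt (fun t => (κ (φ t m)).2) ((1 : ℝ →L[ℝ] ℝ).smulRight (s (φ t m))) t := by
    intro m t ht
    have h := HasMFDerivAt.comp (f := fun t => φ t m) t
      (hasMFDerivAt_chart_snd hκ ht).mdifferentiableAt.hasMFDerivAt (hφ m t)
    refine (hasMFDerivAt_iff_hasFDerivAt.1 h).congr_fderiv (ContinuousLinearMap.ext fun r => ?_)
    exact (mfderiv I 𝓘(ℝ, ℝ) (fun y => (κ y).2) (φ t m)).map_smul r (X (φ t m))
  set Ω : Set (M × ℝ) := {p | φ p.2 p.1 ∈ κ.source} with hΩ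
  have hact : Continuous fun p : M × ℝ => φ p.2 p.1 := φ.continuous continuous_snd continuous_fst
  have hΩ' : Ω ∈ 𝓝 (x, (0 : ℝ)) :=
    hact.continuousAt.preimage_mem_nhds (κ.open_source.mem_nhds (by simpa using hx))
  have happ : ∀ c : NNReal, 0 < c → ∃ r > 0, ∀ᶠ m in 𝓝 x,
      ApproximatesLinearOn (fun t => (κ (φ t m)).2) (A : ℝ →L[ℝ] ℝ) (Metric.ball 0 r) c := by
    intro c hc
    have hcont : ContinuousAt (fun p : M × ℝ => s (φ p.2 p.1)) (x, 0) := by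
      refine ContinuousAt.comp (g := s) ?_ hact.continuousAt
      simpa using hsc.continuousAt (κ.open_source.mem_nhds hx)
    have hev : ∀ᶠ p in 𝓝 (x, (0 : ℝ)), p ∈ Ω ∧ ‖s (φ p.2 p.1) - s x‖ ≤ c := by
      refine Filter.Eventually.and hΩ' ?_
      have := hcont (Metric.closedBall_mem_nhds _ (NNReal.coe_pos.2 hc))
      filter_upwards [this] with p hp
      simpa [dist_eq_norm] using hp
    rw [nhds_prod_eq, eventually_prod_iff] at hev
    obtain ⟨pU, hpU, pD, hpD, hUD⟩ := hev
    obtain ⟨r, hr, hball⟩ := Metric.eventually_nhds_iff_ball.1 hpD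
    refine ⟨r, hr, ?_⟩
    filter_upwards [hpU] with m hm
    intro t ht t' ht'
    refine (convex_ball (0 : ℝ) r).norm_image_sub_le_of_norm_hasFDerivWithin_le'
      (fun y hy => (hder m y (hUD hm (hball y hy)).1).hasFDerivWithinAt) (fun y hy => ?_) ht' ht
    have h := (hUD hm (hball y hy)).2
    have hA : (1 : ℝ →L[ℝ] ℝ).smulRight (s (φ y m)) - (A : ℝ →L[ℝ] ℝ) =
        (1 : ℝ →L[ℝ] ℝ).smulRight (s (φ y m) - s x) := by
      ext
      simp [A]
    rw [hA]
    simpa using h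
  obtain ⟨U, hU, r, hr, a, ha, hax, hsol⟩ := exists_continuousOn_implicit (z₀ := x) (a₀ := (0 : ℝ))
    (θ := fun m t => (κ (φ t m)).2) A happ hΩ' (by
      rintro ⟨m, t⟩ hm
      exact continuousAt_snd.comp
        ((κ.continuousAt hm).comp (φ.continuous_toFun t).continuousAt))
  simp only [φ.map_zero_apply] at hsol
  refine ⟨U, Metric.ball 0 r, plaque κ (κ x).2, a, hU, Metric.ball_mem_nhds _ hr, ⟨hx, rfl⟩,
    fun q hq => ?_, ha, hax, fun m hm => ?_, fun m hm t ht htm => ?_⟩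
  · have := 𝓕.nhds_leafTopology hκ hq.1
    rw [hq.2] at this
    rw [this, Equiv.coe_refl, comap_id, id]
  · exact ⟨(hsol m hm).1 _ (hsol m hm).2.1, (hsol m hm).2.2.1⟩
  · exact (hsol m hm).2.2.2 t ht htm.2

/-- A map preserving a metric is differentiable at the points of positive dimension, because
`mfderiv` vanishes where a map is not differentiable. -/
theorem _root_.PreservesMetric.mdifferentiableAt
    {g : Bundle.ContMDiffRiemannianMetric I ∞ E (fun x : M => TangentSpace I x)} {f : M → M}
    (hf : PreservesMetric g f) {x : M} {v : TangentSpace I x} (hv : v ≠ 0) :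
    MDifferentiableAt I I f x := by
  by_contra h
  have h₁ := hf x v v
  rw [mfderiv_zero_of_not_mdifferentiableAt h] at h₁
  have h₂ := g.pos x v hv
  rw [← h₁] at h₂
  simp at h₂

end Foliation

/-! ### Slices for locally free actions of Lie groups -/

section LieGroupAction

variable {E : Type*} [NormedAddCommGroup E] [NormedSpace ℝ E]
  {H : Type*} [TopologicalSpace H] {I : ModelWithCorners ℝ E H}
  {M : Type*} [TopologicalSpace M] [ChartedSpace H M]
  {E' : Type*} [NormedAddCommGroup E'] [NormedSpace ℝ E']
  {H' : Type*} [TopologicalSpace H'] {J : ModelWithCorners ℝ E' H'}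
  {K : Type*} [Group K] [TopologicalSpace K] [ChartedSpace H' K]
  [MulAction K M] [ContMDiffSMul J I ∞ K M]

theorem contMDiff_orbit (x : M) : ContMDiff J I ∞ fun k : K => k • x :=
  contMDiff_id.smul contMDiff_const

/-- The orbit map `k ↦ k • x` carries the left invariant vector fields to the translates of its
differential at the identity. -/
theorem mfderiv_orbit_mulInvariantVectorField [LieGroup J ∞ K] (x : M) (ξ : GroupLieAlgebra J K)
    (k : K) :
    mfderiv J I (fun k : K => k • x) k (mulInvariantVectorField ξ k) =
      mfderiv I I (fun y : M => k • y) ((1 : K) • x) (mfderiv J I (fun k : K => k • x) 1 ξ) := by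
  have hne : (∞ : WithTop ℕ∞) ≠ 0 := by simp
  have horb : ∀ k, MDifferentiableAt J I (fun k : K => k • x) k := fun k =>
    (contMDiff_orbit x).mdifferentiable hne k
  have h₁ := mfderiv_comp_apply_of_eq (I := J) (I' := J) (I'' := I) (g := fun k : K => k • x)
    (f := fun k' : K => k * k') (x := 1) (y := k) (horb k)
    ((contMDiff_mul_left (n := ∞)).mdifferentiable hne 1) (mul_one k) ξ
  have h₂ := mfderiv_comp_apply (I := J) (I' := I) (I'' := I) (g := fun y : M => k • y)
    (f := fun k : K => k • x) (1 : K)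
    ((ContMDiffSMul.contMDiff_const_smul (I := J) (I' := I) (M := M) (n := ∞) k).mdifferentiable hne _) (horb 1) ξ
  have h₃ : (fun k : K => k • x) ∘ (fun k' : K => k * k') =
      (fun y : M => k • y) ∘ (fun k : K => k • x) := funext fun k' => mul_smul k k' x
  rw [h₃] at h₁
  exact h₁.symm.trans h₂

/-- The differential at the identity of an orbit map of a locally free action is injective: an
integral curve of the left invariant vector field of a vector in the kernel would stay in the
stabilizer. -/
theorem injective_mfderiv_orbit [LieGroup J ∞ K] [J.Boundaryless] [CompleteSpace E']
    [IsManifold I ∞ M] [I.Boundaryless] [CompleteSpace E] {x : M}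
    (hx : DiscreteTopology (MulAction.stabilizer K x)) :
    Function.Injective (mfderiv J I (fun k : K => k • x) 1) := by
  have : LieGroup J (minSmoothness ℝ 3) K :=
    LieGroup.of_le (n := ∞) (by simpa using ENat.LEInfty.out)
  have : IsManifold I 1 M := IsManifold.of_le (n := ∞) (by simp)
  have hne : (∞ : WithTop ℕ∞) ≠ 0 := by simp
  rw [injective_iff_map_eq_zero]
  intro ξ hξ
  obtain ⟨γ, hγ₀, hγ⟩ := exists_isMIntegralCurveAt_of_contMDiffAt_boundaryless (I := J) (t₀ := 0)
    (v := mulInvariantVectorField ξ) (x₀ := (1 : K))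
    ((contMDiffAt_mulInvariantVectorField ξ).of_le (by simp))
  have hzero : IsMIntegralCurveAt (I := I) (fun t => γ t • x) 0 0 := by
    filter_upwards [hγ] with t ht
    have h := HasMFDerivAt.comp (I' := J) (I'' := I) (g := fun k : K => k • x) (f := γ) t
      ((contMDiff_orbit x).mdifferentiable hne (γ t)).hasMFDerivAt ht
    refine h.congr_mfderiv (ContinuousLinearMap.ext fun (r : ℝ) => ?_)
    change mfderiv J I (fun k : K => k • x) (γ t)
      ((r • mulInvariantVectorField ξ (γ t) : TangentSpace J (γ t))) =
        (r • (0 : TangentSpace I (γ t • x)) : TangentSpace I (γ t • x))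
    rw [map_smul, mfderiv_orbit_mulInvariantVectorField, hξ, map_zero]
    rfl
  have hconst : (fun t => γ t • x) =ᶠ[𝓝 0] fun _ => x := by
    refine isMIntegralCurveAt_eventuallyEq_of_contMDiffAt_boundaryless (I := I) (v := 0)
      (Bundle.contMDiff_zeroSection ℝ (TangentSpace I : M → Type _)).contMDiffAt hzero ?_ ?_
    · refine Eventually.of_forall fun t => (hasMFDerivAt_const x t).congr_mfderiv ?_
      ext
      exact (smul_zero (1 : ℝ)).symm
    · simp [hγ₀]
  -- `γ` is constant, as the stabilizer is discrete
  obtain ⟨U, hU, hUx⟩ := isOpen_induced_iff.1 (isOpen_discrete {(1 : MulAction.stabilizer K x)})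
  have h1U : (1 : K) ∈ U := by
    have : (1 : MulAction.stabilizer K x) ∈ Subtype.val ⁻¹' U := hUx ▸ mem_singleton _
    exact this
  have hγ1 : γ =ᶠ[𝓝 0] fun _ => 1 := by
    have hγU : ∀ᶠ t in 𝓝 0, γ t ∈ U :=
      hγ.hasMFDerivAt.continuousAt (hU.mem_nhds (by rwa [hγ₀]))
    filter_upwards [hγU, hconst] with t ht₁ ht₂
    have : (⟨γ t, ht₂⟩ : MulAction.stabilizer K x) ∈ ({1} : Set _) := hUx ▸ ht₁
    exact congrArg Subtype.val (mem_singleton_iff.1 this)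
  have h₀ := hasMFDerivAt_unique hγ.hasMFDerivAt
    ((hasMFDerivAt_const (I := 𝓘(ℝ, ℝ)) (I' := J) (1 : K) (0 : ℝ)).congr_of_eventuallyEq hγ1)
  have h₁ : mulInvariantVectorField ξ (γ 0) = 0 := by
    have h := DFunLike.congr_fun h₀ (1 : ℝ)
    exact (one_smul ℝ (mulInvariantVectorField ξ (γ 0))).symm.trans h
  rw [hγ₀, mulInvariantVectorField] at h₁
  have h₂ : (fun k : K => 1 * k) = id := funext one_mul
  rw [h₂, mfderiv_id] at h₁
  exact h₁

end LieGroupAction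

namespace Foliation

variable {E : Type*} [NormedAddCommGroup E] [NormedSpace ℝ E] [FiniteDimensional ℝ E]
  {H : Type*} [TopologicalSpace H] {I : ModelWithCorners ℝ E H} [I.Boundaryless]
  {M : Type*} [TopologicalSpace M] [ChartedSpace H M] [IsManifold I ∞ M]
  {E' : Type*} [NormedAddCommGroup E'] [NormedSpace ℝ E'] [FiniteDimensional ℝ E']
  {H' : Type*} [TopologicalSpace H'] {J : ModelWithCorners ℝ E' H'} [J.Boundaryless]
  {K : Type*} [Group K] [TopologicalSpace K] [ChartedSpace H' K] [LieGroup J ∞ K]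
  [MulAction K M] [ContMDiffSMul J I ∞ K M]
  {F : Type*} [NormedAddCommGroup F] [NormedSpace ℝ F]
  {G : Type*} [NormedAddCommGroup G] [NormedSpace ℝ G] [FiniteDimensional ℝ G]

/-- A locally free action whose orbits are complementary to a foliation has local slices: the
plaques of the foliated charts. -/
theorem hasLocalSlice_smul (𝓕 : Foliation I M F G) {x : M}
    (hx : DiscreteTopology (MulAction.stabilizer K x))
    (hT : IsCompl (orbitTangentSpace I J K x) (𝓕.tangentSpace ((1 : K) • x))) :
    @HasLocalSlice K _ _ M M _ 𝓕.leafTopology _ (Equiv.refl M) x := by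
  obtain ⟨κ, hκ, hx₁⟩ := 𝓕.cover ((1 : K) • x)
  have hxs : x ∈ κ.source := by simpa using hx₁
  have hne : (∞ : WithTop ℕ∞) ≠ 0 := by simp
  set e := extChartAt J (1 : K) with he
  have he₁ : e.symm (e 1) = 1 := extChartAt_to_inv (I := J) (1 : K)
  have heC : ContMDiffAt 𝓘(ℝ, E') J ∞ e.symm (e 1) :=
    (contMDiffOn_extChartAt_symm (1 : K)).contMDiffAt (extChartAt_target_mem_nhds 1)
  have hκx : κ.symm (κ x) = x := κ.left_inv hxs
  have hκsymm : ContMDiffAt 𝓘(ℝ, F × G) I ∞ κ.symm (κ x) :=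
    (𝓕.contMDiffOn_symm κ hκ).contMDiffAt (κ.open_target.mem_nhds (κ.map_source hxs))
  have hκ₂ : ContMDiffAt I 𝓘(ℝ, G) ∞ (fun y => (κ y).2) ((1 : K) • x) :=
    (contDiff_snd.contMDiff.comp_contMDiffOn (𝓕.contMDiffOn_chart κ hκ)).contMDiffAt
      (κ.open_source.mem_nhds hx₁)
  -- the transverse coordinate of the action, in charts
  have hΘ : ContDiffAt ℝ ∞
      (fun p : (F × G) × E' => (κ (e.symm p.2 • κ.symm p.1)).2) (κ x, e 1) := by
    have h₁ : ContMDiffAt 𝓘(ℝ, (F × G) × E') J ∞ (fun p : (F × G) × E' => e.symm p.2)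
        (κ x, e 1) := ContMDiffAt.comp (κ x, e 1) (g := e.symm) heC contDiff_snd.contMDiff.contMDiffAt
    have h₂ : ContMDiffAt 𝓘(ℝ, (F × G) × E') I ∞ (fun p : (F × G) × E' => κ.symm p.1)
        (κ x, e 1) :=
      ContMDiffAt.comp (κ x, e 1) (g := κ.symm) hκsymm contDiff_fst.contMDiff.contMDiffAt
    exact (ContMDiffAt.comp_of_eq (g := fun y => (κ y).2) hκ₂ (h₁.smul h₂)
      (by simp [he₁, hκx])).contDiffAt
  obtain ⟨D, hD⟩ : ∃ D, HasStrictFDerivAt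
      (fun p : (F × G) × E' => (κ (e.symm p.2 • κ.symm p.1)).2) D (κ x, e 1) :=
    ⟨_, hΘ.hasStrictFDerivAt hne⟩
  -- the partial derivative in the direction of the group is invertible
  have hDA : D.comp (ContinuousLinearMap.inr ℝ (F × G) E') =
      ((mfderiv I 𝓘(ℝ, G) (fun y => (κ y).2) ((1 : K) • x)).comp
        (mfderiv J I (fun k : K => k • x) 1)).comp (mfderiv 𝓘(ℝ, E') J e.symm (e 1)) := by
    have h₁ := hD.hasFDerivAt.comp (e 1) (hasFDerivAt_prodMk_right (𝕜 := ℝ) (κ x) (e 1))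
    have h₂ := HasMFDerivAt.comp (1 : K) (hκ₂.mdifferentiableAt hne).hasMFDerivAt
      ((contMDiff_orbit (J := J) (I := I) x).mdifferentiable hne 1).hasMFDerivAt
    have h₂' : ∀ k : K, k = 1 → HasMFDerivAt J 𝓘(ℝ, G) ((fun y => (κ y).2) ∘ fun k : K => k • x) k
        ((mfderiv I 𝓘(ℝ, G) (fun y => (κ y).2) ((1 : K) • x)).comp
          (mfderiv J I (fun k : K => k • x) 1)) := by
      rintro _ rfl
      exact h₂
    have h₃ := HasMFDerivAt.comp (f := e.symm) (e 1) (h₂' _ he₁) (heC.mdifferentiableAt hne).hasMFDerivAt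
    have h₄ := hasMFDerivAt_iff_hasFDerivAt.1 h₃
    refine h₁.unique (h₄.congr_of_eventuallyEq (Eventually.of_forall fun a => ?_))
    simp [hκx]
  have hbij : Function.Bijective (D.comp (ContinuousLinearMap.inr ℝ (F × G) E')) := by
    have hT₀ : ∀ u : TangentSpace I ((1 : K) • x), u ∈ 𝓕.tangentSpace ((1 : K) • x) ↔
        mfderiv I 𝓘(ℝ, G) (fun y => (κ y).2) ((1 : K) • x) u = 0 :=
      fun u => mem_tangentSpace_iff hκ hx₁
    have hinj : Function.Injective ((mfderiv I 𝓘(ℝ, G) (fun y => (κ y).2) ((1 : K) • x)).comp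
        (mfderiv J I (fun k : K => k • x) 1)) := by
      rw [injective_iff_map_eq_zero]
      intro ξ hξ
      have h := Submodule.disjoint_def.1 hT.disjoint _ (LinearMap.mem_range_self _ ξ)
        ((hT₀ _).2 hξ)
      exact injective_mfderiv_orbit (J := J) (I := I) hx (h.trans (map_zero _).symm)
    have hsurj : Function.Surjective ((mfderiv I 𝓘(ℝ, G) (fun y => (κ y).2) ((1 : K) • x)).comp
        (mfderiv J I (fun k : K => k • x) 1)) := by
      intro c
      obtain ⟨u, hu⟩ := surjective_mfderiv_chart_snd hκ hx₁ c
      obtain ⟨_, ⟨ξ, rfl⟩, n, hn, rfl⟩ := Submodule.mem_sup.1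
        (hT.sup_eq_top ▸ Submodule.mem_top : u ∈ _ ⊔ _)
      refine ⟨ξ, ?_⟩
      rw [map_add, (hT₀ n).1 hn, add_zero] at hu
      exact hu
    have he_bij : Function.Bijective (mfderiv 𝓘(ℝ, E') J e.symm (e 1)) := by
      have h := isInvertible_mfderivWithin_extChartAt_symm (I := J) (mem_extChartAt_target (1 : K))
      rw [J.range_eq_univ, mfderivWithin_univ] at h
      obtain ⟨L, hL⟩ := h
      rw [← he] at hL
      rw [← hL]
      exact L.bijective
    rw [hDA]
    exact (show Function.Bijective _ from ⟨hinj, hsurj⟩).comp he_bij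
  let A : E' ≃L[ℝ] G := ContinuousLinearEquiv.ofBijective _
    (LinearMap.ker_eq_bot.2 hbij.1) (LinearMap.range_eq_top.2 hbij.2)
  have hA : (A : E' →L[ℝ] G) = D.comp (ContinuousLinearMap.inr ℝ (F × G) E') :=
    ContinuousLinearEquiv.coe_ofBijective _ _ _
  have happ : ∀ c : NNReal, 0 < c → ∃ r > 0, ∀ᶠ m in 𝓝 x,
      ApproximatesLinearOn (fun a => (κ (e.symm a • m)).2) (A : E' →L[ℝ] G)
        (Metric.ball (e 1) r) c := by
    intro c hc
    obtain ⟨s, hs, hDs⟩ := hD.approximates_deriv_on_nhds (Or.inr hc)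
    rw [nhds_prod_eq, mem_prod_iff] at hs
    obtain ⟨S, hS, T, hT, hST⟩ := hs
    obtain ⟨r, hr, hball⟩ := Metric.mem_nhds_iff.1 hT
    refine ⟨r, hr, ?_⟩
    filter_upwards [κ.open_source.mem_nhds hxs, κ.continuousAt hxs hS] with m hm hmS
    intro a ha a' ha'
    have h := hDs (κ m, a) (hST ⟨hmS, hball ha⟩) (κ m, a') (hST ⟨hmS, hball ha'⟩)
    simpa [hA, κ.left_inv hm] using h
  have : ContinuousSMul K M := ContMDiffSMul.continuousSMul (I := J) (I' := I) ∞
  set Ω : Set (M × E') := {p | p.2 ∈ e.target ∧ e.symm p.2 • p.1 ∈ κ.source} with hΩ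
  have hΩ' : Ω ∈ 𝓝 (x, e 1) := by
    have h₁ : ContinuousAt (fun p : M × E' => e.symm p.2) (x, e 1) :=
      ContinuousAt.comp (g := e.symm) (f := Prod.snd) heC.continuousAt continuousAt_snd
    refine inter_mem (continuousAt_snd (extChartAt_target_mem_nhds 1))
      ((h₁.smul continuousAt_fst).preimage_mem_nhds (κ.open_source.mem_nhds ?_))
    simpa [he₁] using hxs
  obtain ⟨U, hU, r, hr, a, ha, hax, hsol⟩ := exists_continuousOn_implicit (z₀ := x) (a₀ := e 1)
    (θ := fun m a => (κ (e.symm a • m)).2) A happ hΩ' (by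
      rintro ⟨m, a⟩ hm
      exact continuousAt_snd.comp
        ((κ.continuousAt hm.2).comp (continuous_const_smul _).continuousAt))
  simp only [he₁, one_smul] at hsol
  refine ⟨U, e.source ∩ e ⁻¹' Metric.ball (e 1) r, plaque κ (κ x).2, fun m => e.symm (a m), hU,
    inter_mem (extChartAt_source_mem_nhds 1)
      ((continuousAt_extChartAt 1).preimage_mem_nhds (Metric.ball_mem_nhds _ hr)), ⟨hxs, rfl⟩,
    fun q hq => ?_, ?_, ?_, fun m hm => ?_, fun m hm k hk hkm => ?_⟩
  · have := 𝓕.nhds_leafTopology hκ hq.1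
    rw [hq.2] at this
    rw [this, Equiv.coe_refl, comap_id, id]
  · exact (continuousOn_extChartAt_symm 1).comp ha fun m hm =>
      ((hsol m hm).1 _ (hsol m hm).2.1).1
  · simp [hax, he₁]
  · exact ⟨((hsol m hm).1 _ (hsol m hm).2.1).2, (hsol m hm).2.2.1⟩
  · have hek := e.left_inv hk.1
    have h := (hsol m hm).2.2.2 (e k) hk.2 (by rw [hek]; exact hkm.2)
    exact hek.symm.trans (congrArg e.symm h)

end Foliation

end

/-! ### Coverings and global product structures -/

theorem proposition7p1
    {E : Type*} [NormedAddCommGroup E] [NormedSpace ℝ E] [FiniteDimensional ℝ E]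
    {H : Type*} [TopologicalSpace H] (I : ModelWithCorners ℝ E H) [I.Boundaryless]
    (M : Type*) [TopologicalSpace M] [ChartedSpace H M] [IsManifold I ∞ M]
    [CompactSpace M] [T2Space M] :
    -- nonsingular vector fields generating an equicontinuous flow
    (∀ (X : ∀ x : M, TangentSpace I x) (φ : Flow ℝ M)
        (F : Type*) [NormedAddCommGroup F] [NormedSpace ℝ F] [FiniteDimensional ℝ F]
        (𝓕 : Foliation I M F ℝ),
      ContMDiff I I.tangent ∞ (fun x => (⟨x, X x⟩ : TangentBundle I M)) →
      (∀ x, X x ≠ 0) →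
      (∀ x, IsMIntegralCurve (I := I) (fun t => φ t x) X) →
      IsEquicontinuousFlow I φ →
      (∀ x, IsCompl (Submodule.span ℝ {X x}) (𝓕.tangentSpace x)) →
      (∀ t, 𝓕.IsPreservedBy (φ t)) →
      (∀ x₀ : M,
        IsCoveringMap (fun q : ℝ × 𝓕.Leaf x₀ => φ q.1 q.2.val) ∧
        (ConnectedSpace M →
          Function.Surjective (fun q : ℝ × 𝓕.Leaf x₀ => φ q.1 q.2.val))) ∧
      (∀ (N : Type*) [TopologicalSpace N] [SimplyConnectedSpace N] (π : N → M),
        IsCoveringMap π → 𝓕.LiftsToGlobalProduct φ π)) ∧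
    -- locally free actions of compact Lie groups
    (∀ {E' : Type*} [NormedAddCommGroup E'] [NormedSpace ℝ E'] [FiniteDimensional ℝ E']
        {H' : Type*} [TopologicalSpace H'] (J : ModelWithCorners ℝ E' H') [J.Boundaryless]
        (K : Type*) [Group K] [TopologicalSpace K] [ChartedSpace H' K] [LieGroup J ∞ K]
        [CompactSpace K] [T2Space K] [MulAction K M] [ContMDiffSMul J I ∞ K M]
        (F : Type*) [NormedAddCommGroup F] [NormedSpace ℝ F] [FiniteDimensional ℝ F]
        (G : Type*) [NormedAddCommGroup G] [NormedSpace ℝ G] [FiniteDimensional ℝ G]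
        (𝓕 : Foliation I M F G),
      IsLocallyFreeAction K M →
      (∀ x, IsCompl (orbitTangentSpace I J K x) (𝓕.tangentSpace ((1 : K) • x))) →
      (∀ k : K, 𝓕.IsPreservedBy (fun x => k • x)) →
      ∀ x₀ : M,
        IsCoveringMap (fun q : K × 𝓕.Leaf x₀ => q.1 • q.2.val) ∧
        (ConnectedSpace M →
          Function.Surjective (fun q : K × 𝓕.Leaf x₀ => q.1 • q.2.val)) ∧
        (∀ (h k : K) (y : 𝓕.Leaf x₀),
          (fun q : K × 𝓕.Leaf x₀ => q.1 • q.2.val) (h * k, y) =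
            h • (fun q : K × 𝓕.Leaf x₀ => q.1 • q.2.val) (k, y))) := by
  refine ⟨fun X φ F _ _ _ 𝓕 hX hX₀ hφ hequi hT hpres => ?_, fun J _ K => ?_⟩
  · obtain ⟨g, hg⟩ := hequi
    have hφc : ∀ t, @Continuous M M 𝓕.leafTopology 𝓕.leafTopology (φ t) := fun t =>
      (hpres t).continuous_leafTopology fun x => (hg t).mdifferentiableAt (hX₀ x)
    have hs := 𝓕.hasLocalVAddSlice_flow hX.continuous hX₀ hφ hT
    have hlc := 𝓕.locallyConnectedSpace_leafTopology
    have hι : @Continuous M M 𝓕.leafTopology _ (Equiv.refl M) :=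
      continuous_id_iff_le.2 𝓕.leafTopology_le
    let _ : AddAction ℝ M := φ.toAddAction
    have _ : ContinuousVAdd ℝ M := ⟨φ.cont'⟩
    have _ : @ContinuousConstVAdd ℝ M 𝓕.leafTopology _ := @ContinuousConstVAdd.mk _ _ (_) _ hφc
    refine ⟨fun x₀ => ⟨?_, fun _ => ?_⟩, fun N _ _ π hπ => ?_⟩
    · exact @isCoveringMap_vadd_component ℝ _ _ _ M M _ 𝓕.leafTopology _ _ (Equiv.refl M) _ _ hlc
        hι (fun _ _ => rfl) hs x₀
    · exact @surjective_vadd_component ℝ _ _ _ M M _ 𝓕.leafTopology _ _ (Equiv.refl M) _ _ hlc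
        hι (fun _ _ => rfl) hs _ x₀
    · have := 𝓕.locallyPathConnectedSpace
      exact exists_lift_flow_isHomeomorph 𝓕.leafTopology_le hlc hπ hφc hs
  · intro _ _ _ _ _ _ _ _ F _ _ _ G _ _ _ 𝓕 hfree hT hpres x₀
    have : IsTopologicalGroup K := topologicalGroup_of_lieGroup J ∞
    have : ContinuousSMul K M := ContMDiffSMul.continuousSMul (I := J) (I' := I) ∞
    have hs : ∀ x, @HasLocalSlice K _ _ M M _ 𝓕.leafTopology _ (Equiv.refl M) x := fun x =>
      𝓕.hasLocalSlice_smul (J := J) (hfree x) (hT x)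
    have hlc := 𝓕.locallyConnectedSpace_leafTopology
    have hι : @Continuous M M 𝓕.leafTopology _ (Equiv.refl M) :=
      continuous_id_iff_le.2 𝓕.leafTopology_le
    have _ : @ContinuousConstSMul K M 𝓕.leafTopology _ := @ContinuousConstSMul.mk _ _ (_) _
      fun k => (hpres k).continuous_leafTopology fun x =>
        (ContMDiffSMul.contMDiff_const_smul (I := J) (I' := I) (n := ∞) k).mdifferentiable
          (by simp) x
    refine ⟨?_, fun _ => ?_, fun h k y => mul_smul h k y.val⟩
    · exact @isCoveringMap_smul_component K _ _ _ M M _ 𝓕.leafTopology _ _ (Equiv.refl M) _ _ hlc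
        hι (fun _ _ => rfl) hs x₀
    · exact @surjective_smul_component K _ _ _ M M _ 𝓕.leafTopology _ _ (Equiv.refl M) _ _ hlc
        hι (fun _ _ => rfl) hs _ x₀
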